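/- **Theorem (gradual allocator independence of the Memsafe-to-Notac translation).** **Flat memory and allocation strategies.** Heaps $H$ are finite partial functions $\mathbb N\rightharpoonup\mathbb Z$. An *allocation strategy* $\alpha$ consists of a set of allocator states, an address $\alpha.\mathbf{null}\in\mathbb N$, and total functions $\mathrm{init}(H)=(H',A')$, $\mathrm{malloc}(H,A,k)=(H',A',a)$, $\mathrm{free}(H,A,a)=(H',A')$. *Symbolic events* are $\mathsf M(k)$ (successful malloc of size $k$), $\mathsf F(k)$ (failed malloc), $\mathsf{Fr}(z)$ (free of the block allocated $z$ successful mallocs earlier). A *client update* $\chi$ sends a heap $H$ and a set $D$ of addresses to a heap $\chi(H)_D$ with the same domain as $H$ that agrees with $H$ off $D$. An *allocation map* $\Phi$ is a set of triples $(a,k;i)$, and $|\Phi|=\bigcup_{(a,k;i)\in\Phi}[a,a+k)$. Playing an event after a sequence $\xi$ from $(\Phi,H,A)$: $\mathsf M(k)$ is possible if malloc returns $(H',A',a)$ with $a\ne\mathbf{null}$, and adds $(a,k;|\xi|+1)$ to $\Phi$; $\mathsf F(k)$ is possible if malloc returns $\mathbf{null}$, and keeps $\Phi$; $\mathsf{Fr}(z)$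 calls free on $a$, where the $z$-th last malloc event of $\xi$ (counting from $0$) is $\mathsf M(k)$ in position $i$ and $(a,k;i)\in\Phi$, and removes $(a,k;i)$. For reserved memory $R\subseteq\mathbb N$, a sequence $\xi$ is *feasible* with a sequence of client updates if its events can be played one after the other, where before each event the next update is applied to the current heap on $|\Phi|\cup R$. The strategy $\alpha$ is *well-formed for $R$* if for every $H$ with $R\subseteq\mathrm{dom}\,H$, $(H_0,A_0)=\mathrm{init}(H)$, and every feasible run of some $\xi$ with updates $\vec\chi$ from $(\emptyset,H_0,A_0)$ to $(\Phi_1,H_1,A_1)$: (1) for entries of $\Phi_1$ with different indices, the regions $[a,a+k)$ are disjoint; (2) $|\Phi_1|\cup R\subseteq\mathrm{dom}\,H_1$; (3) $H=H_0$ on $R$; (4) in the last event (if $\xi$ is non-empty) the heap on which the allocator is called, i.e. the heap after the client update, agrees with $H_1$ on $|\Phi'|\cup R$, where $\Phi'$ is the allocation map before the event (on $|\Phi_1|\cup R$ if the event is a free); (5) $|\Phi_1|\cap R=\emptyset$; (6) $\mathbf{null}\notin|\Phi_1|\cup R$; (7) entries of $\Phi_1$ with different indices have different addresses; (8) if $(a,0;i)\in\Phi_1$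 then $a\notin|\Phi_1|\cup R$; (9) for every sequence of updates of the same length as $\vec\chi$, $\xi$ is feasible from $(\emptyset,H_0,A_0)$ as well, with some final map $\Phi_2$ such that every $(a,k;i)\in\Phi_1$ has some $(a',k;i)\in\Phi_2$. **Notac.** Expressions: integers, variables, binary integer operations (comparisons give $1$ or $0$), $*e$, $\&x$, $\mathtt{NULL}$. Commands: $lv:=e$, $lv:=\mathtt{cast}(e)$, $\mathtt{malloc}(lv,e)$, $\mathtt{free}(e)$, $\mathtt{skip}$, $c;c$, $\mathtt{if}$, $\mathtt{while}$, $\mathtt{observe}(e)$, where $lv$ is $x$ or $*e$. An environment $E$ is a partial map from variables to addresses; $x$ denotes the cell $H(E(x))$, $\mathtt{NULL}$ denotes $\alpha.\mathbf{null}$. Commands have the usual small-step semantics on configurations $\langle c;H,A\rangle$, with terminal configurations $\langle\mathtt{stop};H,A\rangle$; writes (including that of the result of a malloc) are stuck outside the domain of the heap, and malloc is stuck on a negative size. The steps of $\mathtt{malloc}$ (of size $n$, result $a$), $\mathtt{free}$, $\mathtt{cast}$, $\mathtt{observe}$ emit the events $\mathit{malloc}(n,a)$ if $a\neq\mathbf{null}$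 and $\mathit{mfail}(n)$ if $a=\mathbf{null}$, $\mathit{free}(a)$, $\mathit{cast}(v)$, $\mathit{obs}(v)$; other steps are silent. $\to_t^*$ denotes a finite number of steps with trace $t$. $\mathcal S(E)$ is the set of strategies that are well-formed for $\mathrm{img}\,E$. **GAI.** Filtering a trace $t$ by a symbolic sequence $\xi$: read both from left to right; $\mathit{malloc}(k,a)$ must be matched by $\mathsf M(k)$ and $\mathit{mfail}(k)$ by $\mathsf F(k)$; $\mathit{free}(a)$ is matched by the next symbolic event if that is some $\mathsf{Fr}(z)$ whose corresponding malloc event was matched by some $\mathit{malloc}(k,a)$, and otherwise goes to the residue; cast and observe events always go to the residue; at the end of $t$ all of $\xi$ must be used. Traces $t_1,t_2$ are *similar*, $t_1\sim t_2$, if for some $\xi$ both can be filtered by $\xi$, with the same residue. Let $\mathcal A(c,E,H,t)$ be the set of $\alpha\in\mathcal S(E)$ such that $\langle c;\alpha.\mathrm{init}(H)\rangle\to^*_{t'}$ for some $t'\sim t$, and $\mathcal P(c,E,H,t,X)=\bigcup_{\eta\in X}\mathcal A(c,E,H,t\cdot\eta)$. Let $D(\eta)$ be the set of all malloc and mfail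 events of size $n$ if $\eta$ is one of these, the set of all casts if $\eta$ is a cast, and $\{\eta\}$ otherwise. $\mathrm{GAI}(c,E,H)$ means: for all $\alpha\in\mathcal S(E)$, $t$, $\eta$ with $\langle c;\alpha.\mathrm{init}(H)\rangle\to_t^*\langle c';H',A'\rangle\to_\eta$ one has $\mathcal P(c,E,H,t,D(\eta))\supseteq\mathcal A(c,E,H,t)$. **Memsafe.** Values are integers, $\mathsf{nil}$, and pointers $(i,b,n)$ (block identifier $i$ from a countably infinite set, block size $b\in\mathbb Z$, offset $n\in\mathbb Z$). A state is a pair of a store $l$ (finite partial map from variables to values) and a heap $m$ (finite partial map from pointers to values). Expressions are built from variables, integers, $\mathsf{nil}$ and $+,\times,-,=,\le$, and evaluate partially: all operations are defined on two integers (comparisons give $1$ or $0$); pointer $+$ integer, integer $+$ pointer and pointer $-$ integer change the offset; $=$ is also defined between values each of which is $\mathsf{nil}$ or a pointer with $0\le n<b$; nothing else is defined. Commands: $\mathsf{skip}$, $c_1;c_2$, $\mathsf{if}$, $\mathsf{while}$ (conditions must be integers; non-zero means true), $x\leftarrow e$, $x\leftarrow[e]$ and $[e_1]\leftarrow e_2$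 ($e$, resp. $e_1$, must be a pointer in $\mathrm{dom}\,m$), and $x\leftarrow\mathsf{alloc}(e)$, which for $e$ evaluating to an integer $n\ge0$ chooses an identifier $i$ that does not occur in the state, sets $x$ to $(i,n,0)$ and $m(i,n,k)=0$ for $0\le k<n$. Everything else is an error. $[\![p]\!](l,m)=(l',m')$ means that $p$ terminates without error in $(l',m')$. **Translation.** Expressions are translated literally, $\mathsf{nil}$ to $\mathtt{NULL}$. Let $oom\neq ti$ be two dedicated variables, and $\mathbf G(c)$ the command $\mathtt{if}(oom)\ \mathtt{skip}\ \mathtt{else}\ c$. $\mathsf{skip}$ and $;$ are translated literally; $\mathsf{if}$, $x\leftarrow e$, $x\leftarrow[e]$, $[e_1]\leftarrow e_2$ are translated to $\mathbf G$ of $\mathtt{if}$, $x:=e$, $x:=*e$, $*e_1:=e_2$; $\mathsf{while}\ e\ \mathsf{do}\ c$ becomes $$g:=(oom==0);\ \mathtt{while}(g)\{\mathtt{if}(e)\ c\ \mathtt{else}\ g:=0;\ g:=(oom==0)*g\}$$ with $e,c$ translated and $g$ a fresh variable for each occurrence of a while loop (the variables $g$ are pairwise distinct, different from $oom,ti$,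 and do not occur in the program or in the domain of the initial store); $x\leftarrow\mathsf{alloc}(e)$ becomes $$\mathbf G\bigl(ti:=e;\ \mathtt{malloc}(x,ti);\ \mathtt{if}(x==\mathtt{NULL})\ oom:=1\ \mathtt{else}\ \mathtt{while}(ti>0)\{ti:=ti-1;\ *(x+ti):=0\}\bigr).$$ **Statement.** Let $p$ be a Memsafe program and $l$ a store all of whose values are integers, and suppose $[\![p]\!](l,\emptyset)=(l',m')$. Let $c$ be the translation of $p$, $E$ an environment that assigns distinct addresses to distinct variables, and $H_0$ a heap with $\mathrm{img}\,E\subseteq\mathrm{dom}\,H_0$, such that all variables of $p$ and all loop variables $g$ of $c$ are in $\mathrm{dom}\,E$; $oom$ and $ti$ do not occur in $p$; $oom,ti\in\mathrm{dom}\,E$ with $H_0(E(oom))=0=H_0(E(ti))$; and every $x\in\mathrm{dom}\,l$ is in $\mathrm{dom}\,E$ with $H_0(E(x))=l(x)$. Then $\mathrm{GAI}(c,E,H_0)$ holds. Moreover, for every $\alpha\in\mathcal S(E)$ with $(H,A)=\alpha.\mathrm{init}(H_0)$, the translated program terminates, $\langle c;H,A\rangle\to_t^*\langle\mathtt{stop};H',A'\rangle$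 for some $t,H',A'$; and whenever it terminates in $H',A'$ without having run out of memory, i.e. $H'(E(oom))=0$, then $l'(x)=H'(E(x))$ for every $x\in\mathrm{dom}\,l'$ whose value $l'(x)$ is an integer. -/

import Mathlib

universe u

/-! ## Finite partial functions -/

/-- Partial functions with finite domain; `f a = none` means that `f` is undefined at `a`. -/
structure FinPMap (α β : Type) where
  toFun : α → Option β
  finite_dom : {a | toFun a ≠ none}.Finite

namespace FinPMap

variable {α β : Type}

instance : CoeFun (FinPMap α β) (fun _ => α → Option β) := ⟨FinPMap.toFun⟩

/-- The domain of definition. -/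
def dom (f : FinPMap α β) : Set α := {a | f a ≠ none}

/-- The partial function that is nowhere defined. -/
def empty : FinPMap α β := ⟨fun _ => none, by simp⟩

/-- `f[a ↦ b]`. -/
def set [DecidableEq α] (f : FinPMap α β) (a : α) (b : β) : FinPMap α β :=
  ⟨Function.update f.toFun a (some b), by
    refine (f.finite_dom.insert a).subset ?_
    intro x hx
    by_cases h : x = a
    · exact Or.inl h
    · exact Or.inr (by simpa [Function.update_of_ne h] using hx)⟩

/-- `f[a ↦ b | a ∈ s]`. -/
def setOn [DecidableEq α] (f : FinPMap α β) (s : Finset α) (b : β) : FinPMap α β :=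
  ⟨fun a => if a ∈ s then some b else f a, by
    refine (s.finite_toSet.union f.finite_dom).subset ?_
    intro x hx
    by_cases h : x ∈ s
    · exact Or.inl h
    · exact Or.inr (by simpa [h] using hx)⟩

end FinPMap

/-! ## Flat memory and allocation strategies -/

/-- Flat memory: finite partial functions from addresses to integers. Addresses and allocation sizes
are natural numbers throughout. -/
abbrev Mem := FinPMap ℕ ℤ
/-- Program variables (shared by both languages). -/
abbrev Var := String

/-- An allocation strategy: a domain of allocator states, the address used as the null value, and
the operations `init`, `malloc`, `free`. -/
structure AllocStrategy where
  State : Type u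
  null : ℕ
  init : Mem → Mem × State
  malloc : Mem → State → ℕ → Mem × State × ℕ
  free : Mem → State → ℕ → Mem × State

/-- Symbolic allocation events: `malloc k` (a successful allocation of size `k`), `fail k`
(a failed one), `free z` (freeing what was allocated `z` successful mallocs earlier). -/
inductive SymbEvent where
  | malloc (k : ℕ)
  | fail (k : ℕ)
  | free (z : ℕ)

/-- Symbolic allocation sequences, in chronological order. -/
abbrev SymbSeq := List SymbEvent

namespace SymbSeq

/-- The `i`-th event of a sequence, counting from 1. -/
def at? (ξ : SymbSeq) : ℕ → Option SymbEvent
  | 0 => none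
  | i + 1 => ξ[i]?

/-- `freeIndex` on the reversed sequence (last event first). -/
def freeIndexRev : List SymbEvent → ℕ → Option ℕ
  | [], _ => none
  | .malloc _ :: r, 0 => some (r.length + 1)
  | .malloc _ :: r, z + 1 => freeIndexRev r z
  | .fail _ :: r, z => freeIndexRev r z
  | .free _ :: r, z => freeIndexRev r z

/-- The index (counting from 1) of the `z`-th malloc event of the sequence, counting mallocs
backwards from 0. -/
def freeIndex (ξ : SymbSeq) (z : ℕ) : Option ℕ := freeIndexRev ξ.reverse z

/-- The free event in position `j` of `ξ` corresponds to the malloc event in position `i`. -/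
def MallocFree (ξ : SymbSeq) (i j : ℕ) : Prop :=
  i < j ∧ ∃ k z, at? ξ i = some (.malloc k) ∧ at? ξ j = some (.free z) ∧
    freeIndex (ξ.take (j - 1)) z = some i

end SymbSeq

/-- Client updates: given a heap `H` and a set `D` of addresses, they modify the contents of `H` on
`D` only; they do not change the domain of the heap. -/
structure ClientUpdate where
  toFun : Mem → Set ℕ → Mem
  off : ∀ H D a, a ∉ D → toFun H D a = H a
  dom_eq : ∀ H D, (toFun H D).dom = H.dom

instance : CoeFun ClientUpdate (fun _ => Mem → Set ℕ → Mem) := ⟨ClientUpdate.toFun⟩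

/-- Allocation maps: sets of triples `(a, k, i)`, where `a` is the address chosen for the malloc of
size `k` in position `i` (counting from 1). -/
abbrev AllocMap := Set (ℕ × ℕ × ℕ)

/-- The allocated addresses `⋃ [a, a + k)`. -/
def AllocMap.addresses (Φ : AllocMap) : Set ℕ :=
  {x | ∃ a k i, (a, k, i) ∈ Φ ∧ a ≤ x ∧ x < a + k}

/-- Heaps agree on a set of addresses. -/
def HeapEq (S : Set ℕ) (H₁ H₂ : Mem) : Prop := ∀ a ∈ S, H₁ a = H₂ a

/-- Step feasibility: `Play α Φ H A ξ e H' A' Φ'` says that after the events `ξ`, with allocation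
map `Φ`, heap `H` and allocator state `A`, the strategy realises the event `e`, leading to
`H'`, `A'`, `Φ'`. -/
inductive Play (α : AllocStrategy.{u}) :
    AllocMap → Mem → α.State → SymbSeq → SymbEvent → Mem → α.State → AllocMap → Prop
  | mallocOk {Φ : AllocMap} {H A} {ξ : SymbSeq} {k H' A' a} :
      α.malloc H A k = (H', A', a) → a ≠ α.null →
      Play α Φ H A ξ (.malloc k) H' A' (Φ ∪ {(a, k, ξ.length + 1)})
  | mallocFail {Φ : AllocMap} {H A} {ξ : SymbSeq} {k H' A' a} :
      α.malloc H A k = (H', A', a) → a = α.null →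
      Play α Φ H A ξ (.fail k) H' A' Φ
  | free {Φ : AllocMap} {H A} {ξ : SymbSeq} {z i k a H' A'} :
      SymbSeq.MallocFree (ξ ++ [.free z]) i (ξ.length + 1) →
      SymbSeq.at? ξ i = some (.malloc k) → (a, k, i) ∈ Φ →
      α.free H A a = (H', A') →
      Play α Φ H A ξ (.free z) H' A' (Φ \ {(a, k, i)})

/-- Sequence feasibility: the strategy realises the sequence of symbolic events, where before each
event a client update is applied to the allocated and the reserved memory. -/
inductive Feasible (α : AllocStrategy.{u}) (R : Set ℕ) :
    AllocMap → Mem → α.State → List ClientUpdate → SymbSeq → Mem → α.State → AllocMap → Prop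
  | empty {Φ H A χs} : Feasible α R Φ H A χs [] H A Φ
  | step {Φ : AllocMap} {H A χs ξ H' A'} {Φ' : AllocMap} {χ : ClientUpdate} {e H'' A'' Φ''} :
      Feasible α R Φ H A χs ξ H' A' Φ' →
      Play α Φ' (χ H' (Φ'.addresses ∪ R)) A' ξ e H'' A'' Φ'' →
      Feasible α R Φ H A (χs ++ [χ]) (ξ ++ [e]) H'' A'' Φ''

/-- The requirements on a strategy with reserved memory `R` for one feasible sequence: `H` is the
heap before initialisation, `H₀, A₀` the result of the initialisation, and `H₁, A₁, Φ₁` the result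
of the events `ξ` interleaved with the client updates `χs`. -/
structure AllocGood (α : AllocStrategy.{u}) (R : Set ℕ) (H H₀ : Mem) (A₀ : α.State)
    (χs : List ClientUpdate) (ξ : SymbSeq) (H₁ : Mem) (A₁ : α.State) (Φ₁ : AllocMap) : Prop where
  /-- allocated regions are disjoint -/
  basic1 : ∀ a k i a' k' i', (a, k, i) ∈ Φ₁ → (a', k', i') ∈ Φ₁ → i ≠ i' →
    Disjoint (Set.Ico a (a + k)) (Set.Ico a' (a' + k'))
  /-- client-accessible memory is in the final heap -/
  basic2 : Φ₁.addresses ∪ R ⊆ H₁.dom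
  /-- initialisation does not update reserved memory -/
  basic3 : HeapEq R H H₀
  /-- the allocator does not modify client-accessible memory: the heap it is called on (that is,
  after the client update) and the heap it returns agree there -/
  basic4 : ∀ ξpre e χs' (χ : ClientUpdate) H' A' Φ', ξ = ξpre ++ [e] →
    Feasible α R ∅ H₀ A₀ χs' ξpre H' A' Φ' →
    Play α Φ' (χ H' (Φ'.addresses ∪ R)) A' ξpre e H₁ A₁ Φ₁ →
    ((∃ z, e = .free z) → HeapEq (Φ₁.addresses ∪ R) (χ H' (Φ'.addresses ∪ R)) H₁) ∧
    ((¬ ∃ z, e = .free z) → HeapEq (Φ'.addresses ∪ R) (χ H' (Φ'.addresses ∪ R)) H₁)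
  /-- allocated addresses do not overlap with reserved memory -/
  basic5 : Φ₁.addresses ∩ R = ∅
  /-- null is not client-accessible -/
  basic6 : α.null ∉ Φ₁.addresses ∪ R
  /-- allocated addresses are not reused -/
  zeroAlloc1 : ∀ a k i a' k' i', (a, k, i) ∈ Φ₁ → (a', k', i') ∈ Φ₁ → i ≠ i' → a ≠ a'
  /-- zero-sized allocations are disjoint from client-updateable memory -/
  zeroAlloc2 : ∀ a k i, (a, k, i) ∈ Φ₁ → k = 0 → a ∉ Φ₁.addresses ∪ R
  /-- client updates do not influence the decisions of the allocator -/
  rel : ∀ χs₂ : List ClientUpdate, χs.length = χs₂.length →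
    ∃ H₂ A₂ Φ₂, Feasible α R ∅ H₀ A₀ χs₂ ξ H₂ A₂ Φ₂ ∧
      ∀ a k i, (a, k, i) ∈ Φ₁ → ∃ a' k' i', (a', k', i') ∈ Φ₂ ∧ k = k' ∧ i = i'

/-- Well-formedness of an allocation strategy for reserved memory `R`. -/
def AllocStrategy.WellFormed (α : AllocStrategy.{u}) (R : Set ℕ) : Prop :=
  ∀ H H₀ A₀ χs ξ H₁ A₁ Φ₁, R ⊆ H.dom → α.init H = (H₀, A₀) →
    Feasible α R ∅ H₀ A₀ χs ξ H₁ A₁ Φ₁ →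
    AllocGood α R H H₀ A₀ χs ξ H₁ A₁ Φ₁

/-! ## The flat-memory language Notac -/

namespace Notac

/-- Binary operators on integers; comparisons and logical connectives yield 1 or 0. -/
inductive BinOp where
  | add | sub | mul | eq | ne | lt | le | gt | ge | and | or

def BinOp.eval : BinOp → ℤ → ℤ → ℤ
  | .add, a, b => a + b
  | .sub, a, b => a - b
  | .mul, a, b => a * b
  | .eq, a, b => if a = b then 1 else 0
  | .ne, a, b => if a = b then 0 else 1
  | .lt, a, b => if a < b then 1 else 0
  | .le, a, b => if a ≤ b then 1 else 0
  | .gt, a, b => if b < a then 1 else 0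
  | .ge, a, b => if b ≤ a then 1 else 0
  | .and, a, b => if a ≠ 0 ∧ b ≠ 0 then 1 else 0
  | .or, a, b => if a ≠ 0 ∨ b ≠ 0 then 1 else 0

inductive Expr where
  | const (n : ℤ)
  | var (x : Var)
  | binop (op : BinOp) (e₁ e₂ : Expr)
  | deref (e : Expr)
  | addrOf (x : Var)
  | null

/-- Assignable expressions: `x` and `*e`. -/
inductive LVal where
  | var (x : Var)
  | deref (e : Expr)

inductive Cmd where
  | assign (lv : LVal) (e : Expr)
  | cast (lv : LVal) (e : Expr)
  | malloc (lv : LVal) (e : Expr)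
  | free (e : Expr)
  | skip
  | seq (c₁ c₂ : Cmd)
  | ite (e : Expr) (c₁ c₂ : Cmd)
  | loop (e : Expr) (c : Cmd)
  | observe (e : Expr)

/-- Variable environments: the addresses of the declared variables. -/
abbrev Env := Var → Option ℕ

/-- The declared variables. -/
def Env.dom (E : Env) : Set Var := {x | E x ≠ none}

/-- The set of addresses of declared variables. -/
def Env.range (E : Env) : Set ℕ := {a | ∃ x, E x = some a}

/-- Distinct declared variables have distinct addresses. -/
def Env.Inj (E : Env) : Prop := ∀ x y a, E x = some a → E y = some a → x = y

/-- Compatibility of an environment and a heap: all variables are accessible. -/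
def Env.Compatible (E : Env) (H : Mem) : Prop := E.range ⊆ H.dom

/-- `H(E(x))`. -/
def Env.lookup (E : Env) (H : Mem) (x : Var) : Option ℤ := (E x).bind (fun a => H a)

/-- An integer as an address. -/
def toAddr (v : ℤ) : Option ℕ := if 0 ≤ v then some v.toNat else none

/-- Evaluation of expressions (undefined where no rule of the semantics applies), in environment
`E`, heap `H`, with null value `null`. -/
def Expr.eval (E : Env) (null : ℕ) (H : Mem) : Expr → Option ℤ
  | .const n => some n
  | .var x => E.lookup H x
  | .binop op e₁ e₂ =>
      (e₁.eval E null H).bind fun n₁ => (e₂.eval E null H).bind fun n₂ => some (op.eval n₁ n₂)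
  | .deref e => ((e.eval E null H).bind toAddr).bind (fun a => H a)
  | .addrOf x => (E x).map (fun a => (a : ℤ))
  | .null => some (null : ℤ)

/-- The address denoted by an assignable expression. -/
def LVal.eval (E : Env) (null : ℕ) (H : Mem) : LVal → Option ℕ
  | .var x => E x
  | .deref e => (e.eval E null H).bind toAddr

/-- Memory-relevant events. -/
inductive Event where
  | observe (v : ℤ)
  | malloc (n : ℕ) (a : ℕ)
  | mallocFail (n : ℕ)
  | free (a : ℕ)
  | cast (v : ℤ)

abbrev Trace := List Event

/-- Small-step semantics `⟨c; H, A⟩ → ⟨r; H', A'⟩`. The event is `none` for silent steps; the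
residual command `r` is `none` for the terminal configuration `stop`. -/
inductive Step (E : Env) (α : AllocStrategy.{u}) :
    Cmd → Mem → α.State → Option Event → Option Cmd → Mem → α.State → Prop
  | skip {H A} : Step E α .skip H A none none H A
  | observe {e H A v} :
      e.eval E α.null H = some v →
      Step E α (.observe e) H A (some (.observe v)) none H A
  | assign {lv e A a v} {H : Mem} :
      lv.eval E α.null H = some a → e.eval E α.null H = some v → a ∈ H.dom →
      Step E α (.assign lv e) H A none none (H.set a v) A
  | cast {lv e A a v} {H : Mem} :
      lv.eval E α.null H = some a → e.eval E α.null H = some v → a ∈ H.dom →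
      Step E α (.cast lv e) H A (some (.cast v)) none (H.set a v) A
  | mallocOk {lv e H A a aₗ A'} {n : ℕ} {H' : Mem} :
      e.eval E α.null H = some (n : ℤ) → α.malloc H A n = (H', A', a) →
      lv.eval E α.null H = some aₗ → aₗ ∈ H'.dom → a ≠ α.null →
      Step E α (.malloc lv e) H A (some (.malloc n a)) none (H'.set aₗ (a : ℤ)) A'
  | mallocFail {lv e H A a aₗ A'} {n : ℕ} {H' : Mem} :
      e.eval E α.null H = some (n : ℤ) → α.malloc H A n = (H', A', a) →
      lv.eval E α.null H = some aₗ → aₗ ∈ H'.dom → a = α.null →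
      Step E α (.malloc lv e) H A (some (.mallocFail n)) none (H'.set aₗ (a : ℤ)) A'
  | free {e H A H' A'} {a : ℕ} :
      e.eval E α.null H = some (a : ℤ) → α.free H A a = (H', A') →
      Step E α (.free e) H A (some (.free a)) none H' A'
  | seq₁ {c₁ c₂ H A η H' A'} :
      Step E α c₁ H A η none H' A' →
      Step E α (.seq c₁ c₂) H A η (some c₂) H' A'
  | seq₂ {c₁ c₂ c₁' H A η H' A'} :
      Step E α c₁ H A η (some c₁') H' A' →
      Step E α (.seq c₁ c₂) H A η (some (.seq c₁' c₂)) H' A'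
  | iteTrue {e c₁ c₂ H A v} :
      e.eval E α.null H = some v → v ≠ 0 →
      Step E α (.ite e c₁ c₂) H A none (some c₁) H A
  | iteFalse {e c₁ c₂ H A v} :
      e.eval E α.null H = some v → v = 0 →
      Step E α (.ite e c₁ c₂) H A none (some c₂) H A
  | loop {e c H A} :
      Step E α (.loop e c) H A none (some (.ite e (.seq c (.loop e c)) .skip)) H A

/-- `Steps E α r H A t r' H' A'`: zero or more steps producing the trace `t`. -/
inductive Steps (E : Env) (α : AllocStrategy.{u}) :
    Option Cmd → Mem → α.State → Trace → Option Cmd → Mem → α.State → Prop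
  | refl {r H A} : Steps E α r H A [] r H A
  | head {c H A η r H' A' t r' H'' A''} :
      Step E α c H A η r H' A' → Steps E α r H' A' t r' H'' A'' →
      Steps E α (some c) H A (η.toList ++ t) r' H'' A''

/-! ### Gradual allocator independence -/

/-- The free of address `a` passes the filter `ξ` after `ξpre`. -/
def FilterFree (Φ : AllocMap) (a : ℕ) (ξpre ξ : SymbSeq) : Prop :=
  ∃ z ξ' i k, ξ = .free z :: ξ' ∧
    SymbSeq.MallocFree (ξpre ++ ξ) i (ξpre.length + 1) ∧
    SymbSeq.at? (ξpre ++ ξ) i = some (.malloc k) ∧ (a, k, i) ∈ Φ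

/-- The symbolic filter relation: the trace is matched against `ξpre / ξ` (already matched / to be
matched), the last argument is the concrete residue. -/
inductive Filter : AllocMap → Trace → SymbSeq → SymbSeq → Trace → Prop
  | mallocPass {Φ : AllocMap} {t ξpre ξ tr k a} :
      Filter (Φ ∪ {(a, k, ξpre.length + 1)}) t (ξpre ++ [.malloc k]) ξ tr →
      Filter Φ (.malloc k a :: t) ξpre (.malloc k :: ξ) tr
  | mfailPass {Φ t ξpre ξ tr k} :
      Filter Φ t (ξpre ++ [.fail k]) ξ tr →
      Filter Φ (.mallocFail k :: t) ξpre (.fail k :: ξ) tr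
  | freePass {Φ t ξpre ξ tr a z} :
      FilterFree Φ a ξpre (.free z :: ξ) →
      Filter Φ t (ξpre ++ [.free z]) ξ tr →
      Filter Φ (.free a :: t) ξpre (.free z :: ξ) tr
  | freeResidue {Φ t ξpre ξ tr a} :
      ¬ FilterFree Φ a ξpre ξ →
      Filter Φ t ξpre ξ tr →
      Filter Φ (.free a :: t) ξpre ξ (.free a :: tr)
  | castResidue {Φ t ξpre ξ tr v} :
      Filter Φ t ξpre ξ tr →
      Filter Φ (.cast v :: t) ξpre ξ (.cast v :: tr)
  | observeResidue {Φ t ξpre ξ tr v} :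
      Filter Φ t ξpre ξ tr →
      Filter Φ (.observe v :: t) ξpre ξ (.observe v :: tr)
  | empty {Φ ξpre} : Filter Φ [] ξpre [] []

/-- Trace similarity: a common symbolic filter leaves the same concrete residue. -/
def TraceSim (t₁ t₂ : Trace) : Prop :=
  ∃ ξ tr, Filter ∅ t₁ [] ξ tr ∧ Filter ∅ t₂ [] ξ tr

/-- The strategies that are well-formed for the memory reserved by the environment. -/
def stratsFor (E : Env) : Set AllocStrategy.{u} := {α | α.WellFormed E.range}

/-- Allocator impact: the strategies that can produce a trace similar to `t`. -/
def impact (c : Cmd) (E : Env) (H : Mem) (t : Trace) : Set AllocStrategy.{u} :=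
  {α | α ∈ stratsFor E ∧ ∃ H₀ A₀ t' r H' A', α.init H = (H₀, A₀) ∧
    Steps E α (some c) H₀ A₀ t' r H' A' ∧ TraceSim t t'}

/-- Progress impact for a set `X` of events. -/
def progImpact (c : Cmd) (E : Env) (H : Mem) (t : Trace) (X : Set Event) :
    Set AllocStrategy.{u} :=
  ⋃ η ∈ X, impact c E H (t ++ [η])

/-- All malloc and malloc-failure events of size `n`. -/
def allocEvents (n : ℕ) : Set Event := {η | (∃ a, η = .malloc n a) ∨ η = .mallocFail n}

/-- All cast events. -/
def castEvents : Set Event := {η | ∃ v, η = .cast v}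

/-- Progress downgrading characterisation of an event. -/
def downgrade : Event → Set Event
  | .malloc n _ => allocEvents n
  | .mallocFail n => allocEvents n
  | .cast _ => castEvents
  | .free a => {.free a}
  | .observe v => {.observe v}

/-- Gradual allocator independence (for initially compatible `E` and `H`). -/
def GAI (c : Cmd) (E : Env) (H : Mem) : Prop :=
  ∀ α ∈ stratsFor.{u} E, ∀ (t : Trace) (η : Event) H₀ A₀ c' H' A' r H'' A'',
    α.init H = (H₀, A₀) →
    Steps E α (some c) H₀ A₀ t (some c') H' A' →
    Step E α c' H' A' (some η) r H'' A'' →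
    impact.{u} c E H t ⊆ progImpact.{u} c E H t (downgrade η)

end Notac

/-! ## The memory-safe language Memsafe -/

namespace Memsafe

/-- Block identifiers. -/
abbrev Ident := ℕ

/-- Values: integers, `nil`, and pointers (block identifier, block size, offset). -/
inductive Val where
  | int (n : ℤ)
  | nil
  | ptr (i : Ident) (b n : ℤ)
  deriving DecidableEq

/-- Local stores. -/
abbrev Store := FinPMap Var Val
/-- Heaps: finite partial functions from pointers to values. -/
abbrev Heap := FinPMap (Ident × ℤ × ℤ) Val

inductive BinOp where
  | add | mul | sub | eq | le

inductive Expr where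
  | var (x : Var)
  | const (n : ℤ)
  | nil
  | binop (op : BinOp) (e₁ e₂ : Expr)

inductive Cmd where
  | skip
  | seq (c₁ c₂ : Cmd)
  | ite (e : Expr) (c₁ c₂ : Cmd)
  | loop (e : Expr) (c : Cmd)
  | assign (x : Var) (e : Expr)
  | load (x : Var) (e : Expr)
  | store (e₁ e₂ : Expr)
  | alloc (x : Var) (e : Expr)

/-- `nil` and in-bounds pointers may be compared with each other. -/
def Val.Comparable : Val → Prop
  | .int _ => False
  | .nil => True
  | .ptr _ b n => 0 ≤ n ∧ n < b

instance : DecidablePred Val.Comparable := fun v => by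
  cases v <;> unfold Val.Comparable <;> infer_instance

/-- Binary operators; `none` where the operation is undefined. -/
def BinOp.eval : BinOp → Val → Val → Option Val
  | .add, .int n₁, .int n₂ => some (.int (n₁ + n₂))
  | .add, .ptr i b n₁, .int n₂ => some (.ptr i b (n₁ + n₂))
  | .add, .int n₁, .ptr i b n₂ => some (.ptr i b (n₁ + n₂))
  | .sub, .int n₁, .int n₂ => some (.int (n₁ - n₂))
  | .sub, .ptr i b n₁, .int n₂ => some (.ptr i b (n₁ - n₂))
  | .mul, .int n₁, .int n₂ => some (.int (n₁ * n₂))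
  | .le, .int n₁, .int n₂ => some (.int (if n₁ ≤ n₂ then 1 else 0))
  | .eq, .int n₁, .int n₂ => some (.int (if n₁ = n₂ then 1 else 0))
  | .eq, v₁, v₂ =>
      if v₁.Comparable ∧ v₂.Comparable then some (.int (if v₁ = v₂ then 1 else 0)) else none
  | _, _, _ => none

/-- Evaluation of expressions, a partial function. -/
def Expr.eval (l : Store) : Expr → Option Val
  | .var x => l x
  | .const n => some (.int n)
  | .nil => some .nil
  | .binop op e₁ e₂ => (e₁.eval l).bind fun v₁ => (e₂.eval l).bind fun v₂ => op.eval v₁ v₂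

/-- The block identifiers that occur in a state. -/
def ids (l : Store) (m : Heap) : Set Ident :=
  {i | ∃ b n, (∃ x, l x = some (.ptr i b n)) ∨ (i, b, n) ∈ m.dom ∨
    ∃ q, m q = some (.ptr i b n)}

/-- The pointers of a block of size `n`. -/
noncomputable def block (i : Ident) (n : ℤ) : Finset (Ident × ℤ × ℤ) :=
  (Finset.Ico 0 n).image fun k => (i, n, k)

/-- Error-free evaluation: `Eval c l m l' m'` says that `c`, started in the state `(l, m)`,
terminates without error in `(l', m')`. Runs that end in an error and runs that diverge have no
derivation. Any identifier that does not occur in the state may be chosen as the fresh one. -/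
inductive Eval : Cmd → Store → Heap → Store → Heap → Prop
  | skip {l m} : Eval .skip l m l m
  | seq {c₁ c₂ l m l' m' l'' m''} :
      Eval c₁ l m l' m' → Eval c₂ l' m' l'' m'' → Eval (.seq c₁ c₂) l m l'' m''
  | iteTrue {e c₁ c₂ l m l' m' n} :
      e.eval l = some (.int n) → n ≠ 0 → Eval c₁ l m l' m' → Eval (.ite e c₁ c₂) l m l' m'
  | iteFalse {e c₁ c₂ l m l' m'} :
      e.eval l = some (.int 0) → Eval c₂ l m l' m' → Eval (.ite e c₁ c₂) l m l' m'
  | loopTrue {e c l m l' m' l'' m'' n} :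
      e.eval l = some (.int n) → n ≠ 0 → Eval c l m l' m' →
      Eval (.loop e c) l' m' l'' m'' → Eval (.loop e c) l m l'' m''
  | loopFalse {e c l m} :
      e.eval l = some (.int 0) → Eval (.loop e c) l m l m
  | assign {x e v m} {l : Store} :
      e.eval l = some v → Eval (.assign x e) l m (l.set x v) m
  | load {x e i b n v} {l : Store} {m : Heap} :
      e.eval l = some (.ptr i b n) → m (i, b, n) = some v →
      Eval (.load x e) l m (l.set x v) m
  | store {e₁ e₂ i b n v l} {m : Heap} :
      e₁.eval l = some (.ptr i b n) → (i, b, n) ∈ m.dom → e₂.eval l = some v →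
      Eval (.store e₁ e₂) l m l (m.set (i, b, n) v)
  | alloc {x e n i} {l : Store} {m : Heap} :
      e.eval l = some (.int n) → 0 ≤ n → i ∉ ids l m →
      Eval (.alloc x e) l m (l.set x (.ptr i n 0)) (m.setOn (block i n) (.int 0))

/-- Variables of an expression. -/
def Expr.vars : Expr → Set Var
  | .var x => {x}
  | .const _ => ∅
  | .nil => ∅
  | .binop _ e₁ e₂ => e₁.vars ∪ e₂.vars

/-- Variables of a program. -/
def Cmd.vars : Cmd → Set Var
  | .skip => ∅
  | .seq c₁ c₂ => c₁.vars ∪ c₂.vars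
  | .ite e c₁ c₂ => e.vars ∪ c₁.vars ∪ c₂.vars
  | .loop e c => e.vars ∪ c.vars
  | .assign x e => {x} ∪ e.vars
  | .load x e => {x} ∪ e.vars
  | .store e₁ e₂ => e₁.vars ∪ e₂.vars
  | .alloc x e => {x} ∪ e.vars

/-- Number of syntactic occurrences of while loops. -/
def Cmd.numLoops : Cmd → ℕ
  | .seq c₁ c₂ => c₁.numLoops + c₂.numLoops
  | .ite _ c₁ c₂ => c₁.numLoops + c₂.numLoops
  | .loop _ c => c.numLoops + 1
  | _ => 0

/-! ### Translation to Notac -/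

def BinOp.toNotac : BinOp → Notac.BinOp
  | .add => .add
  | .mul => .mul
  | .sub => .sub
  | .eq => .eq
  | .le => .le

def Expr.toNotac : Expr → Notac.Expr
  | .var x => .var x
  | .const n => .const n
  | .nil => .null
  | .binop op e₁ e₂ => .binop op.toNotac e₁.toNotac e₂.toNotac

/-- The guard macro `if (oom) skip else c`. -/
def memGuard (oom : Var) (c : Notac.Cmd) : Notac.Cmd := .ite (.var oom) .skip c

/-- The translation. `oom` and `ti` are the dedicated variables, and `g j` is the guard variable of
the `j`-th occurrence of a while loop (in textual order, starting with `j = s`). -/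
def Cmd.toNotac (oom ti : Var) (g : ℕ → Var) : ℕ → Cmd → Notac.Cmd
  | _, .skip => .skip
  | s, .seq c₁ c₂ =>
      .seq (c₁.toNotac oom ti g s) (c₂.toNotac oom ti g (s + c₁.numLoops))
  | s, .ite e c₁ c₂ =>
      memGuard oom (.ite e.toNotac (c₁.toNotac oom ti g s)
        (c₂.toNotac oom ti g (s + c₁.numLoops)))
  | s, .loop e c =>
      -- g := (oom == 0); while (g) { if (e) c else g := 0; g := (oom == 0) * g }
      .seq (.assign (.var (g s)) (.binop .eq (.var oom) (.const 0)))
        (.loop (.var (g s))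
          (.seq (.ite e.toNotac (c.toNotac oom ti g (s + 1)) (.assign (.var (g s)) (.const 0)))
            (.assign (.var (g s))
              (.binop .mul (.binop .eq (.var oom) (.const 0)) (.var (g s))))))
  | _, .assign x e => memGuard oom (.assign (.var x) e.toNotac)
  | _, .load x e => memGuard oom (.assign (.var x) (.deref e.toNotac))
  | _, .store e₁ e₂ => memGuard oom (.assign (.deref e₁.toNotac) e₂.toNotac)
  | _, .alloc x e =>
      -- ti := e; malloc(x, ti);
      -- if (x == NULL) oom := 1 else while (ti > 0) { ti := ti - 1; *(x + ti) := 0 }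
      memGuard oom
        (.seq (.assign (.var ti) e.toNotac)
          (.seq (.malloc (.var x) (.var ti))
            (.ite (.binop .eq (.var x) .null)
              (.assign (.var oom) (.const 1))
              (.loop (.binop .gt (.var ti) (.const 0))
                (.seq (.assign (.var ti) (.binop .sub (.var ti) (.const 1)))
                  (.assign (.deref (.binop .add (.var x) (.var ti))) (.const 0)))))))

end Memsafe

/-! A translated program never frees, casts or observes, so its traces contain only successful and
failed allocations. On such traces a filter works symbol by symbol and ignores addresses, so
similarity is equality of the lists of kinds and sizes (`TraceSim.map_symb?_eq`,
`TraceSim.of_map_symb?_eq`). It therefore suffices that all strategies receive the same sequence of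
requests until one of them fails.

This follows by simulating the given Memsafe run under an arbitrary strategy. While allocations
succeed, the flat heap represents the Memsafe state (`Rep`): integers represent themselves, `nil` is
the null address, and a pointer is the base address of its block plus the offset. Integer-valued
conditions and sizes then do not depend on placement. The one delicate operation is equality, which
is defined only for `nil` and in-bounds pointers; there it is faithful, since allocated regions are
disjoint and null lies in none of them (`Rep.eq_iff`). When an allocation fails, `oom` is set, and
the rest of the program terminates silently (`Exhausted.steps`). Hence one list of sizes, read off
from the Memsafe derivation, serves all strategies (`exists_simulates`), and every trace follows it
up to the first failure.

Independence is then a statement about traces along a common list (`gai_of_allocTrace`). If one run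
continues after `t` with a request, then `t` contains no failure; a run of another strategy with the
same symbols must continue with a request of the same size, and its outcome is covered by the
downgrading. Since execution is deterministic, partial runs are initial parts of the terminating
one. The final claim is the representation of integers by themselves.

Well-formedness speaks only of feasible runs with client updates. `Tracked` connects it to program
runs: all writes between two allocator calls are merged into one client update. -/

namespace FinPMap

variable {α β : Type}

/-! ### Elementary facts on finite partial functions -/

theorem ext {f g : FinPMap α β} (h : ∀ a, f a = g a) : f = g := by
  cases f; cases g; congr; exact funext h

theorem mem_dom_of_eq {f : FinPMap α β} {a : α} {b : β} (h : f a = some b) : a ∈ f.dom := by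
  simp [dom, h]

theorem exists_of_mem_dom {f : FinPMap α β} {a : α} (h : a ∈ f.dom) : ∃ b, f a = some b :=
  Option.ne_none_iff_exists'.1 h

variable [DecidableEq α]

@[simp] theorem set_self (f : FinPMap α β) (a : α) (b : β) : f.set a b a = some b := by
  simp [set]

theorem set_of_ne (f : FinPMap α β) {a x : α} (b : β) (h : x ≠ a) : f.set a b x = f x := by
  simp [set, h]

theorem dom_set_of_mem {f : FinPMap α β} {a : α} (b : β) (h : a ∈ f.dom) :
    (f.set a b).dom = f.dom := by
  ext x
  by_cases hx : x = a
  · subst hx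
    simpa [dom] using h
  · simp [dom, set_of_ne f b hx]

theorem set_eq_self {f : FinPMap α β} {a : α} {b : β} (h : f a = some b) : f.set a b = f := by
  refine ext fun x => ?_
  by_cases hx : x = a
  · subst hx; simp [h]
  · exact set_of_ne f b hx

end FinPMap

/-! ## Tracking the heap of a client of an allocation strategy -/

open Classical in
/-- The client update that replaces a heap by `T`, where this is permitted. -/
noncomputable def ClientUpdate.toward (T : Mem) : ClientUpdate where
  toFun H D := if T.dom = H.dom ∧ ∀ a ∉ D, T a = H a then T else H
  off H D a ha := by
    split_ifs with h
    · exact h.2 a ha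
    · rfl
  dom_eq H D := by
    split_ifs with h
    · exact h.1
    · rfl

/-- A client update must be legitimate for every heap and every set, so a constant function would
not do; the fallback to the identity is never taken under these conditions. -/
theorem ClientUpdate.toward_eq {T H : Mem} {D : Set ℕ} (h : T.dom = H.dom)
    (h' : ∀ a ∉ D, T a = H a) : ClientUpdate.toward T H D = T :=
  if_pos ⟨h, h'⟩

/-- Every feasible run from `Hi, Ai` satisfies the requirements on allocation strategies. -/
def GoodInit (α : AllocStrategy.{u}) (R : Set ℕ) (H₀ Hi : Mem) (Ai : α.State) : Prop :=
  ∀ χs ξ H₁ A₁ Φ₁, Feasible α R ∅ Hi Ai χs ξ H₁ A₁ Φ₁ → AllocGood α R H₀ Hi Ai χs ξ H₁ A₁ Φ₁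

/-- The heap `H` results from a feasible run that ends with the allocation map `Φ` by changes of
the client-accessible memory. -/
def Tracked (α : AllocStrategy.{u}) (R : Set ℕ) (Hi : Mem) (Ai : α.State) (Φ : AllocMap)
    (H : Mem) (A : α.State) : Prop :=
  ∃ χs ξ H₁, Feasible α R ∅ Hi Ai χs ξ H₁ A Φ ∧ H.dom = H₁.dom ∧
    (∀ x ∉ Φ.addresses ∪ R, H x = H₁ x) ∧ ∀ a k i, (a, k, i) ∈ Φ → i ≤ ξ.length

namespace Tracked

variable {α : AllocStrategy.{u}} {R : Set ℕ} {H₀ Hi H : Mem} {Ai A : α.State} {Φ : AllocMap}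

theorem init : Tracked α R Hi Ai ∅ Hi Ai :=
  ⟨[], [], Hi, .empty, rfl, fun _ _ => rfl, by simp⟩

theorem set (h : Tracked α R Hi Ai Φ H A) {a : ℕ} (v : ℤ) (ha : a ∈ Φ.addresses ∪ R)
    (hd : a ∈ H.dom) : Tracked α R Hi Ai Φ (H.set a v) A := by
  obtain ⟨χs, ξ, H₁, hf, hdom, hoff, hlen⟩ := h
  refine ⟨χs, ξ, H₁, hf, (FinPMap.dom_set_of_mem v hd).trans hdom, fun x hx => ?_, hlen⟩
  rw [FinPMap.set_of_ne _ _ (ne_of_mem_of_not_mem ha hx).symm, hoff x hx]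

theorem subset_dom (hg : GoodInit α R H₀ Hi Ai) (h : Tracked α R Hi Ai Φ H A) :
    Φ.addresses ∪ R ⊆ H.dom := by
  obtain ⟨χs, ξ, H₁, hf, hdom, -⟩ := h
  exact hdom ▸ (hg _ _ _ _ _ hf).basic2

theorem disjoint (hg : GoodInit α R H₀ Hi Ai) (h : Tracked α R Hi Ai Φ H A) {a k i a' k' i' : ℕ}
    (h₁ : (a, k, i) ∈ Φ) (h₂ : (a', k', i') ∈ Φ) (hi : i ≠ i') :
    Disjoint (Set.Ico a (a + k)) (Set.Ico a' (a' + k')) := by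
  obtain ⟨χs, ξ, H₁, hf, -⟩ := h
  exact (hg _ _ _ _ _ hf).basic1 _ _ _ _ _ _ h₁ h₂ hi

theorem notMem_reserved (hg : GoodInit α R H₀ Hi Ai) (h : Tracked α R Hi Ai Φ H A) {a : ℕ}
    (ha : a ∈ Φ.addresses) : a ∉ R := by
  obtain ⟨χs, ξ, H₁, hf, -⟩ := h
  intro hR
  have := (hg _ _ _ _ _ hf).basic5
  exact (this ▸ (⟨ha, hR⟩ : a ∈ Φ.addresses ∩ R) : a ∈ (∅ : Set ℕ))

theorem null_notMem (hg : GoodInit α R H₀ Hi Ai) (h : Tracked α R Hi Ai Φ H A) :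
    α.null ∉ Φ.addresses := by
  obtain ⟨χs, ξ, H₁, hf, -⟩ := h
  exact fun hn => (hg _ _ _ _ _ hf).basic6 (Or.inl hn)

/-- The pending writes are replayed as one client update towards `H`, which extends the feasible run
by one event; clause `basic4` for that event says that the allocator left the client's memory alone.
-/
theorem mallocOk (hg : GoodInit α R H₀ Hi Ai) (h : Tracked α R Hi Ai Φ H A) {k a : ℕ} {H' : Mem}
    {A' : α.State} (hm : α.malloc H A k = (H', A', a)) (ha : a ≠ α.null) :
    ∃ i, Tracked α R Hi Ai (Φ ∪ {(a, k, i)}) H' A' ∧ (∀ b n, (b, n, i) ∉ Φ) ∧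
      HeapEq (Φ.addresses ∪ R) H H' := by
  obtain ⟨χs, ξ, H₁, hf, hdom, hoff, hlen⟩ := h
  have hχ : ClientUpdate.toward H H₁ (Φ.addresses ∪ R) = H := ClientUpdate.toward_eq hdom hoff
  have hp : Play α Φ (ClientUpdate.toward H H₁ (Φ.addresses ∪ R)) A ξ (.malloc k) H' A' _ :=
    .mallocOk (hχ.symm ▸ hm) ha
  have hf' := hf.step hp
  have := ((hg _ _ _ _ _ hf').basic4 _ _ _ _ _ _ _ rfl hf hp).2 (by simp)
  -- Positions count from 1, and all earlier entries have index at most `ξ.length`, so this index is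
  -- new.
  refine ⟨ξ.length + 1, ⟨_, _, _, hf', rfl, fun _ _ => rfl, ?_⟩, ?_, hχ ▸ this⟩
  · rintro b n i (hi | hi)
    · have := hlen _ _ _ hi
      simp; omega
    · simp only [Set.mem_singleton_iff, Prod.mk.injEq] at hi
      simp [hi.2.2]
  · intro b n hb
    have := hlen _ _ _ hb
    omega

theorem mallocFail (hg : GoodInit α R H₀ Hi Ai) (h : Tracked α R Hi Ai Φ H A) {k a : ℕ} {H' : Mem}
    {A' : α.State} (hm : α.malloc H A k = (H', A', a)) (ha : a = α.null) :
    Tracked α R Hi Ai Φ H' A' ∧ HeapEq (Φ.addresses ∪ R) H H' := by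
  obtain ⟨χs, ξ, H₁, hf, hdom, hoff, hlen⟩ := h
  have hχ : ClientUpdate.toward H H₁ (Φ.addresses ∪ R) = H := ClientUpdate.toward_eq hdom hoff
  have hp : Play α Φ (ClientUpdate.toward H H₁ (Φ.addresses ∪ R)) A ξ (.fail k) H' A' Φ :=
    .mallocFail (hχ.symm ▸ hm) ha
  have hf' := hf.step hp
  have := ((hg _ _ _ _ _ hf').basic4 _ _ _ _ _ _ _ rfl hf hp).2 (by simp)
  refine ⟨⟨_, _, _, hf', rfl, fun _ _ => rfl, fun b n i hi => ?_⟩, hχ ▸ this⟩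
  have := hlen _ _ _ hi
  simp; omega

end Tracked

/-! ## Runs of Notac programs -/

namespace Notac

variable {E : Env} {α : AllocStrategy.{u}}

theorem Step.det {c : Cmd} {H H₁ H₂ : Mem} {A A₁ A₂ : α.State} {η₁ η₂ : Option Event}
    {r₁ r₂ : Option Cmd} (h₁ : Step E α c H A η₁ r₁ H₁ A₁) (h₂ : Step E α c H A η₂ r₂ H₂ A₂) :
    η₁ = η₂ ∧ r₁ = r₂ ∧ H₁ = H₂ ∧ A₁ = A₂ := by
  induction h₁ generalizing η₂ r₂ H₂ A₂ with
  | skip => cases h₂; simp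
  | observe h => cases h₂; simp_all
  | assign => cases h₂; simp_all
  | cast => cases h₂; simp_all
  | mallocOk => cases h₂ <;> simp_all
  | mallocFail => cases h₂ <;> simp_all
  | free => cases h₂; simp_all
  | seq₁ _ ih =>
    cases h₂ with
    | seq₁ h => simpa using ih h
    | seq₂ h => simpa using ih h
  | seq₂ _ ih =>
    cases h₂ with
    | seq₁ h => simpa using ih h
    | seq₂ h => simpa using ih h
  | iteTrue => cases h₂ <;> simp_all
  | iteFalse => cases h₂ <;> simp_all
  | loop => cases h₂; simp

theorem Steps.single {c : Cmd} {H H' : Mem} {A A' : α.State} {η : Option Event} {r : Option Cmd}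
    (h : Step E α c H A η r H' A') : Steps E α (some c) H A η.toList r H' A' := by
  simpa using Steps.head h .refl

theorem Steps.silent {c : Cmd} {H H' H'' : Mem} {A A' A'' : α.State} {t : Trace}
    {r r' : Option Cmd} (h : Step E α c H A none r H' A') (h' : Steps E α r H' A' t r' H'' A'') :
    Steps E α (some c) H A t r' H'' A'' :=
  Steps.head h h'

theorem Steps.seq {c₁ c₂ : Cmd} {H H' H'' : Mem} {A A' A'' : α.State} {t t' : Trace}
    {r : Option Cmd} (h₁ : Steps E α (some c₁) H A t none H' A')
    (h₂ : Steps E α (some c₂) H' A' t' r H'' A'') :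
    Steps E α (some (.seq c₁ c₂)) H A (t ++ t') r H'' A'' := by
  generalize hr : some c₁ = r₁ at h₁
  generalize hn : (none : Option Cmd) = r₂ at h₁
  induction h₁ generalizing c₁ with
  | refl => subst hr; cases hn
  | @head c H A η r _ _ _ _ _ _ hs _ ih =>
    cases hr
    rw [List.append_assoc]
    cases r with
    | none =>
      subst hn
      rename_i hs'
      cases hs'
      simpa using Steps.head (.seq₁ hs) h₂
    | some c' => exact .head (.seq₂ hs) (ih h₂ rfl hn)

theorem Steps.seq_silent {c₁ c₂ : Cmd} {H H' H'' : Mem} {A A' A'' : α.State} {t : Trace}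
    {r : Option Cmd} (h₁ : Steps E α (some c₁) H A [] none H' A')
    (h₂ : Steps E α (some c₂) H' A' t r H'' A'') :
    Steps E α (some (.seq c₁ c₂)) H A t r H'' A'' :=
  h₁.seq h₂

theorem Steps.of_none {H H' : Mem} {A A' : α.State} {t : Trace} {r : Option Cmd}
    (h : Steps E α none H A t r H' A') : t = [] ∧ r = none ∧ H' = H ∧ A' = A := by
  cases h; simp

/-- By determinism two runs from the same configuration agree step by step, and a terminal
configuration has no successor, so the terminating run is the longer one. -/
theorem Steps.prefix_of_terminal {r₀ r : Option Cmd} {H H' H'' : Mem} {A A' A'' : α.State}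
    {t t' : Trace} (h : Steps E α r₀ H A t r H' A') (h' : Steps E α r₀ H A t' none H'' A'') :
    ∃ t₂, t' = t ++ t₂ ∧ Steps E α r H' A' t₂ none H'' A'' := by
  induction h generalizing t' with
  | refl => exact ⟨t', rfl, h'⟩
  | head hs _ ih =>
    cases h' with
    | head hs' hr =>
      obtain ⟨rfl, rfl, rfl, rfl⟩ := hs.det hs'
      obtain ⟨t₂, rfl, h₂⟩ := ih hr
      exact ⟨t₂, by simp, h₂⟩

/-- A step emits at most one event, so a run can be cut at any point of its trace. -/
theorem Steps.exists_prefix {r r' : Option Cmd} {H H' : Mem} {A A' : α.State} {t t₁ t₂ : Trace}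
    (h : Steps E α r H A t r' H' A') (ht : t = t₁ ++ t₂) :
    ∃ r'' H'' A'', Steps E α r H A t₁ r'' H'' A'' := by
  induction h generalizing t₁ with
  | refl =>
    obtain ⟨rfl, -⟩ := List.append_eq_nil_iff.1 ht.symm
    exact ⟨_, _, _, .refl⟩
  | @head c H A η r _ _ t _ _ _ hs _ ih =>
    cases η with
    | none =>
      obtain ⟨r'', H'', A'', h⟩ := ih ht
      exact ⟨r'', H'', A'', .silent hs h⟩
    | some e =>
      cases t₁ with
      | nil => exact ⟨_, _, _, .refl⟩
      | cons e' t₁ =>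
        simp only [Option.toList_some, List.cons_append, List.nil_append, List.cons.injEq] at ht
        obtain ⟨rfl, ht⟩ := ht
        obtain ⟨r'', H'', A'', h⟩ := ih ht
        exact ⟨r'', H'', A'', by simpa using Steps.head hs h⟩

/-! ### Traces of allocation events -/

/-- The symbolic event that filters a malloc or malloc-failure event. -/
def Event.symb? : Event → Option SymbEvent
  | .malloc n _ => some (.malloc n)
  | .mallocFail n => some (.fail n)
  | _ => none

/-- Without free, cast and observe events nothing can enter the residue, and the allocation map,
which only decides about frees, plays no role. -/
theorem Filter.map_symb? {Φ : AllocMap} {t tr : Trace} {ξpre ξ : SymbSeq}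
    (h : Filter Φ t ξpre ξ tr) (ht : none ∉ t.map Event.symb?) :
    t.map Event.symb? = ξ.map some ∧ tr = [] := by
  induction h <;> simp_all [Event.symb?]

theorem Filter.of_map_symb? {t : Trace} {ξ : SymbSeq} (h : t.map Event.symb? = ξ.map some)
    (Φ : AllocMap) (ξpre : SymbSeq) : Filter Φ t ξpre ξ [] := by
  induction t generalizing ξ Φ ξpre with
  | nil =>
    obtain rfl : ξ = [] := by simpa using h.symm
    exact .empty
  | cons e t ih =>
    cases ξ with
    | nil => simp at h
    | cons s ξ =>
      simp only [List.map_cons, List.cons.injEq] at h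
      cases e with
      | malloc n a =>
        obtain rfl := Option.some.inj h.1
        exact .mallocPass (ih h.2 _ _)
      | mallocFail n =>
        obtain rfl := Option.some.inj h.1
        exact .mfailPass (ih h.2 _ _)
      | free a => exact absurd h.1 (by simp [Event.symb?])
      | cast v => exact absurd h.1 (by simp [Event.symb?])
      | observe v => exact absurd h.1 (by simp [Event.symb?])

theorem TraceSim.map_symb?_eq {t₁ t₂ : Trace} (h : TraceSim t₁ t₂)
    (h₁ : none ∉ t₁.map Event.symb?) (h₂ : none ∉ t₂.map Event.symb?) :
    t₁.map Event.symb? = t₂.map Event.symb? := by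
  obtain ⟨ξ, tr, f₁, f₂⟩ := h
  rw [(f₁.map_symb? h₁).1, (f₂.map_symb? h₂).1]

theorem TraceSim.of_map_symb?_eq {t₁ t₂ : Trace}
    (h : t₁.map Event.symb? = t₂.map Event.symb?) (h₁ : none ∉ t₁.map Event.symb?) :
    TraceSim t₁ t₂ := by
  obtain ⟨ξ, hξ⟩ : ∃ ξ : SymbSeq, t₁.map Event.symb? = ξ.map some := by
    generalize t₁.map Event.symb? = s at h₁
    refine ⟨s.reduceOption, ?_⟩
    induction s with
    | nil => rfl
    | cons o s ih =>
      cases o with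
      | none => simp at h₁
      | some e =>
        simp only [List.mem_cons, not_or] at h₁
        simpa using ih h₁.2
  exact ⟨ξ, [], .of_map_symb? hξ _ _, .of_map_symb? (h ▸ hξ) _ _⟩

/-- The symbols of successful allocations of the given sizes. -/
def successes (ns : List ℕ) : List (Option SymbEvent) := ns.map fun n => some (.malloc n)

/-- Some of the first allocations of the given sizes succeed, the next one fails. -/
def FailsAlong (ns : List ℕ) (s : List (Option SymbEvent)) : Prop :=
  ∃ pre n suf, ns = pre ++ n :: suf ∧ s = successes pre ++ [some (.fail n)]

theorem FailsAlong.append_right {ns : List ℕ} {s : List (Option SymbEvent)}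
    (h : FailsAlong ns s) (ns' : List ℕ) : FailsAlong (ns ++ ns') s := by
  obtain ⟨pre, n, suf, rfl, rfl⟩ := h
  exact ⟨pre, n, suf ++ ns', by simp, rfl⟩

theorem FailsAlong.append_left {ns : List ℕ} {s : List (Option SymbEvent)}
    (h : FailsAlong ns s) (ns' : List ℕ) : FailsAlong (ns' ++ ns) (successes ns' ++ s) := by
  obtain ⟨pre, n, suf, rfl, rfl⟩ := h
  exact ⟨ns' ++ pre, n, suf, by simp, by simp [successes]⟩

/-- Allocations of the given sizes are requested one after the other, up to the first failure. -/
def AllocTrace (ns : List ℕ) (t : Trace) : Prop :=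
  t.map Event.symb? = successes ns ∨ FailsAlong ns (t.map Event.symb?)

theorem AllocTrace.none_notMem {ns : List ℕ} {t : Trace} (h : AllocTrace ns t) :
    none ∉ t.map Event.symb? := by
  rcases h with h | ⟨pre, n, suf, -, h⟩ <;> rw [h] <;> simp [successes]

theorem AllocTrace.cons {ns : List ℕ} {e : Event} {t : Trace} (h : AllocTrace ns (e :: t)) :
    ∃ n ns', ns = n :: ns' ∧
      (e.symb? = some (.fail n) ∧ t = [] ∨ e.symb? = some (.malloc n) ∧ AllocTrace ns' t) := by
  rcases h with h | ⟨pre, n, suf, rfl, h⟩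
  · cases ns with
    | nil => simp [successes] at h
    | cons n ns =>
      simp only [successes, List.map_cons, List.cons.injEq] at h
      exact ⟨n, ns, rfl, .inr ⟨h.1, .inl h.2⟩⟩
  · cases pre with
    | nil =>
      simp only [successes, List.map_cons, List.map_nil, List.nil_append, List.cons.injEq,
        List.map_eq_nil_iff] at h
      exact ⟨n, suf, rfl, .inl h⟩
    | cons k pre =>
      simp only [successes, List.map_cons, List.cons_append, List.cons.injEq] at h
      exact ⟨k, _, rfl, .inr ⟨h.1, .inr ⟨pre, n, suf, rfl, h.2⟩⟩⟩

/-- A failure ends a trace along `ns`, so the event `e` after `t` shows that `t` consists of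
successes only. The other trace has then used up the same part of `ns` without failing, and the next
entry of `ns` forces a request of the same size. -/
theorem AllocTrace.next {ns : List ℕ} {t t' u u' : Trace} {e : Event}
    (h : AllocTrace ns (t ++ e :: u)) (h' : AllocTrace ns (t' ++ u'))
    (ht : t.map Event.symb? = t'.map Event.symb?) :
    ∃ e' u'', u' = e' :: u'' ∧ e' ∈ downgrade e := by
  induction t generalizing ns t' with
  | nil =>
    obtain rfl : t' = [] := by simpa using ht.symm
    obtain ⟨n, ns, rfl, hn⟩ := AllocTrace.cons h
    cases u' with
    -- A trace along a non-empty list is non-empty, even if the first request fails.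
    | nil => rcases h' with h' | ⟨pre, k, suf, -, h'⟩ <;> simp [successes] at h'
    | cons e' u' =>
      obtain ⟨n', ns', hns, hn'⟩ := AllocTrace.cons h'
      obtain ⟨rfl, rfl⟩ := List.cons.inj hns
      refine ⟨e', u', rfl, ?_⟩
      have he : e.symb? = some (.fail n) ∨ e.symb? = some (.malloc n) :=
        hn.imp And.left And.left
      have he' : e'.symb? = some (.fail n) ∨ e'.symb? = some (.malloc n) :=
        hn'.imp And.left And.left
      cases e <;> cases e' <;> simp_all [Event.symb?, downgrade, allocEvents]
  | cons x t ih =>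
    cases t' with
    | nil => simp at ht
    | cons x' t' =>
      simp only [List.map_cons, List.cons.injEq] at ht
      obtain ⟨n, ns, rfl, hn⟩ := AllocTrace.cons h
      obtain ⟨n', ns', hns, hn'⟩ := AllocTrace.cons h'
      obtain ⟨rfl, rfl⟩ := List.cons.inj hns
      rcases hn with ⟨-, hn⟩ | ⟨hx, hn⟩
      · simp at hn
      · rcases hn' with ⟨hx', -⟩ | ⟨-, hn'⟩
        · rw [← ht.1, hx] at hx'
          simp at hx'
        · exact ih hn hn' ht.2

/-- Programs whose terminating runs, under every strategy, request allocations of the same sizes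
up to the first failure are gradually allocator independent. -/
theorem gai_of_allocTrace {c : Cmd} {H : Mem} (ns : List ℕ)
    (h : ∀ α ∈ stratsFor.{u} E, ∀ H₀ A₀, α.init H = (H₀, A₀) →
      ∃ t H' A', Steps E α (some c) H₀ A₀ t none H' A' ∧ AllocTrace ns t) : GAI.{u} c E H := by
  rintro α hα t η H₀ A₀ c' H' A' r H'' A'' hi hs hη β ⟨hβ, K₀, B₀, t', r', K', B', hi', hs', hsim⟩
  obtain ⟨tα, Hα, Aα, hrα, htα⟩ := h α hα _ _ hi
  obtain ⟨tβ, Hβ, Aβ, hrβ, htβ⟩ := h β hβ _ _ hi'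
  -- Both partial runs are completed to the terminating runs: that of `α` has trace `t`, then `η`,
  -- then `u`, and that of `β` starts with `t'`.
  obtain ⟨u₁, rfl, hu⟩ := hs.prefix_of_terminal hrα
  obtain ⟨u, rfl, -⟩ := (Steps.single hη).prefix_of_terminal hu
  obtain ⟨v, rfl, -⟩ := hs'.prefix_of_terminal hrβ
  have hnα := htα.none_notMem
  have hnβ := htβ.none_notMem
  simp only [List.map_append, List.mem_append, not_or] at hnα hnβ
  have heq := hsim.map_symb?_eq hnα.1 hnβ.1
  obtain ⟨η', v, rfl, hη'⟩ := AllocTrace.next htα htβ heq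
  -- The run of `β` stopped right after its answer `η'` is the required witness.
  obtain ⟨r₂, H₂, A₂, h₂⟩ := hrβ.exists_prefix (t₁ := t' ++ [η']) (t₂ := v) (by simp)
  refine Set.mem_iUnion₂.2 ⟨η', hη', hβ, K₀, B₀, _, r₂, H₂, A₂, hi', h₂,
    .of_map_symb?_eq (by simp [heq]) ?_⟩
  simp only [List.map_append, List.mem_append, not_or]
  refine ⟨hnα.1, ?_⟩
  have := hnβ.2
  simp only [List.map_cons, List.mem_cons, not_or] at this
  simpa using this.1

/-! ### Variables -/

theorem Env.lookup_set_self {x : Var} {a : ℕ} (h : E x = some a) (H : Mem) (v : ℤ) :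
    E.lookup (H.set a v) x = some v := by
  simp [Env.lookup, h]

theorem Env.lookup_set_of_ne (hE : E.Inj) {x y : Var} {a : ℕ} (h : E x = some a) (hy : y ≠ x)
    (H : Mem) (v : ℤ) : E.lookup (H.set a v) y = E.lookup H y := by
  unfold Env.lookup
  cases hb : E y with
  | none => rfl
  | some b => exact FinPMap.set_of_ne _ _ fun e => hy (hE _ _ _ (e ▸ hb) h)

theorem Env.lookup_congr {H H' : Mem} (h : HeapEq E.range H H') (x : Var) :
    E.lookup H x = E.lookup H' x := by
  unfold Env.lookup
  cases hb : E x with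
  | none => rfl
  | some b => exact h b ⟨x, hb⟩

theorem Env.exists_of_mem_dom {x : Var} (h : x ∈ E.dom) : ∃ a, E x = some a :=
  Option.ne_none_iff_exists'.1 h

theorem Steps.assignVar {x : Var} {e : Expr} {a : ℕ} {v : ℤ} {H : Mem} {A : α.State}
    (hx : E x = some a) (he : e.eval E α.null H = some v) (ha : a ∈ H.dom) :
    Steps E α (some (.assign (.var x) e)) H A [] none (H.set a v) A :=
  .silent (.assign (by simpa [LVal.eval] using hx) he ha) .refl

theorem Steps.ite_true {e : Expr} {c₁ c₂ : Cmd} {v : ℤ} {H H' : Mem} {A A' : α.State} {t : Trace}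
    {r : Option Cmd} (he : e.eval E α.null H = some v) (hv : v ≠ 0)
    (h : Steps E α (some c₁) H A t r H' A') : Steps E α (some (.ite e c₁ c₂)) H A t r H' A' :=
  .silent (.iteTrue he hv) h

theorem Steps.ite_false {e : Expr} {c₁ c₂ : Cmd} {H H' : Mem} {A A' : α.State} {t : Trace}
    {r : Option Cmd} (he : e.eval E α.null H = some 0)
    (h : Steps E α (some c₂) H A t r H' A') : Steps E α (some (.ite e c₁ c₂)) H A t r H' A' :=
  .silent (.iteFalse he rfl) h

theorem Steps.skip {H : Mem} {A : α.State} : Steps E α (some .skip) H A [] none H A :=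
  .silent .skip .refl

theorem Steps.loop_true {e : Expr} {c : Cmd} {v : ℤ} {H H' H'' : Mem} {A A' A'' : α.State}
    {t t' : Trace} {r : Option Cmd} (he : e.eval E α.null H = some v) (hv : v ≠ 0)
    (h : Steps E α (some c) H A t none H' A')
    (h' : Steps E α (some (.loop e c)) H' A' t' r H'' A'') :
    Steps E α (some (.loop e c)) H A (t ++ t') r H'' A'' :=
  .silent .loop (.ite_true he hv (h.seq h'))

theorem Steps.loop_false {e : Expr} {c : Cmd} {H : Mem} {A : α.State}
    (he : e.eval E α.null H = some 0) : Steps E α (some (.loop e c)) H A [] none H A :=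
  .silent .loop (.ite_false he .skip)

theorem toAddr_natCast (a : ℕ) : toAddr a = some a := by
  simp [toAddr]

end Notac

namespace Memsafe

open Notac (Env Steps successes FailsAlong)

/-! ## Representation of Memsafe states -/

/-- Merges the patterns of the definition into two alternatives, which avoids a split over all pairs
of constructors later on. -/
theorem BinOp.eval_eq (v₁ v₂ : Val) :
    BinOp.eq.eval v₁ v₂ = match v₁, v₂ with
      | .int n₁, .int n₂ => some (.int (if n₁ = n₂ then 1 else 0))
      | v₁, v₂ =>
        if v₁.Comparable ∧ v₂.Comparable then some (.int (if v₁ = v₂ then 1 else 0)) else none := by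
  cases v₁ <;> cases v₂ <;> rfl

/-- The address, size and allocation index of each block. -/
abbrev Placement := Ident → Option (ℕ × ℕ × ℕ)

/-- The integer that represents a value. -/
def Val.Rel (null : ℕ) (ρ : Placement) : Val → ℤ → Prop
  | .int n, w => w = n
  | .nil, w => w = null
  | .ptr i b n, w => ∃ a k j, ρ i = some (a, k, j) ∧ b = k ∧ w = a + n

/-- The auxiliary variables of the translation: they are declared and distinct. -/
structure Layout (E : Env) (oom ti : Var) (g : ℕ → Var) (N : ℕ) : Prop where
  inj : E.Inj
  oom_mem : oom ∈ E.dom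
  ti_mem : ti ∈ E.dom
  oom_ne_ti : oom ≠ ti
  g_injOn : Set.InjOn g {j | j < N}
  g_mem : ∀ j < N, g j ∈ E.dom
  g_ne_oom : ∀ j < N, g j ≠ oom
  g_ne_ti : ∀ j < N, g j ≠ ti

/-- The variables that programs may use. -/
structure Admissible (E : Env) (oom ti : Var) (g : ℕ → Var) (N : ℕ) (x : Var) : Prop where
  mem : x ∈ E.dom
  ne_oom : x ≠ oom
  ne_ti : x ≠ ti
  ne_g : ∀ j < N, x ≠ g j

/-- The heap `H` represents the Memsafe state `l, m`, and there has been no failure. -/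
structure Rep (E : Env) (oom ti : Var) (g : ℕ → Var) (N : ℕ) (α : AllocStrategy.{u})
    (Hi : Mem) (Ai : α.State) (ρ : Placement) (Φ : AllocMap) (l : Store) (m : Heap)
    (H : Mem) (A : α.State) : Prop where
  tracked : Tracked α E.range Hi Ai Φ H A
  placed : ∀ {i a k j}, ρ i = some (a, k, j) → (a, k, j) ∈ Φ
  separate : ∀ {i i' a a' k k' j}, ρ i = some (a, k, j) → ρ i' = some (a', k', j) → i = i'
  store : ∀ {x v}, l x = some v → ∃ w, E.lookup H x = some w ∧ v.Rel α.null ρ w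
  heap : ∀ {i b n v}, m (i, b, n) = some v → ∃ a k j o w, ρ i = some (a, k, j) ∧ b = (k : ℤ) ∧
    n = (o : ℕ) ∧ o < k ∧ H (a + o) = some w ∧ v.Rel α.null ρ w
  oom_eq : E.lookup H oom = some 0
  ti_eq : E.lookup H ti = some 0
  unused : ∀ j < N, l (g j) = none

/-- The program has run out of memory. -/
structure Exhausted (E : Env) (oom : Var) (H : Mem) : Prop where
  compatible : E.Compatible H
  oom_ne : ∃ v, v ≠ 0 ∧ E.lookup H oom = some v

section

variable {E : Env} {oom ti : Var} {g : ℕ → Var} {N : ℕ} {α : AllocStrategy.{u}} {H₀ Hi : Mem}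
  {Ai A : α.State} {ρ : Placement} {Φ : AllocMap} {l : Store} {m : Heap} {H : Mem}

theorem mem_addresses {a k j o : ℕ} (h : (a, k, j) ∈ Φ) (ho : o < k) : a + o ∈ Φ.addresses :=
  ⟨a, k, j, h, by omega, by omega⟩

namespace Rep

/-- Regions with different allocation indices are disjoint, so a shared address forces equal
indices, and an index belongs to one block only. -/
theorem eq_of_addr_eq (h : Rep E oom ti g N α Hi Ai ρ Φ l m H A)
    (hg : GoodInit α E.range H₀ Hi Ai) {i i' a a' k k' j j' o o' : ℕ}
    (h₁ : ρ i = some (a, k, j)) (h₂ : ρ i' = some (a', k', j')) (ho : o < k) (ho' : o' < k')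
    (ha : a + o = a' + o') : i = i' ∧ o = o' := by
  have hj : j = j' := by
    by_contra hj
    have h₁' : a + o ∈ Set.Ico a (a + k) := ⟨by omega, by omega⟩
    have h₂' : a + o ∈ Set.Ico a' (a' + k') := ⟨by omega, by omega⟩
    exact Set.disjoint_left.1 (h.tracked.disjoint hg (h.placed h₁) (h.placed h₂) hj) h₁' h₂'
  subst hj
  obtain rfl := h.separate h₁ h₂
  obtain ⟨rfl, rfl⟩ : a = a' ∧ k = k' := by simpa [h₁] using h₂
  exact ⟨rfl, by omega⟩

/-- An in-bounds pointer denotes an allocated address, which is neither null nor an address of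
another cell. Comparability cannot be dropped: an out-of-bounds pointer may coincide numerically
with a pointer into another block. -/
theorem eq_iff (h : Rep E oom ti g N α Hi Ai ρ Φ l m H A)
    (hg : GoodInit α E.range H₀ Hi Ai) {v₁ v₂ : Val} {w₁ w₂ : ℤ} (h₁ : v₁.Rel α.null ρ w₁)
    (h₂ : v₂.Rel α.null ρ w₂) (hc₁ : v₁.Comparable) (hc₂ : v₂.Comparable) :
    v₁ = v₂ ↔ w₁ = w₂ := by
  have key : ∀ {i b n w}, (Val.ptr i b n).Rel α.null ρ w → (Val.ptr i b n).Comparable →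
      ∃ a k j o, ρ i = some (a, k, j) ∧ b = (k : ℤ) ∧ n = (o : ℕ) ∧ o < k ∧
        w = ((a + o : ℕ) : ℤ) := by
    rintro i b n w ⟨a, k, j, hρ, rfl, rfl⟩ ⟨h0, hk⟩
    lift n to ℕ using h0
    exact ⟨a, k, j, n, hρ, rfl, rfl, by omega, by push_cast; rfl⟩
  have hnull : ∀ {i a k j o : ℕ}, ρ i = some (a, k, j) → o < k → α.null ≠ a + o :=
    fun hρ ho e => h.tracked.null_notMem hg (e ▸ mem_addresses (h.placed hρ) ho)
  cases v₁ with
  | int => exact hc₁.elim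
  | nil =>
    cases v₂ with
    | int => exact hc₂.elim
    | nil => simp_all [Val.Rel]
    | ptr =>
      obtain ⟨a, k, j, o, hρ, rfl, rfl, ho, rfl⟩ := key h₂ hc₂
      have := hnull hρ ho
      simp only [Val.Rel] at h₁
      simp only [reduceCtorEq, false_iff]
      omega
  | ptr =>
    obtain ⟨a, k, j, o, hρ, rfl, rfl, ho, rfl⟩ := key h₁ hc₁
    cases v₂ with
    | int => exact hc₂.elim
    | nil =>
      have := hnull hρ ho
      simp only [Val.Rel] at h₂
      simp only [reduceCtorEq, false_iff]
      omega
    | ptr =>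
      obtain ⟨a', k', j', o', hρ', rfl, rfl, ho', rfl⟩ := key h₂ hc₂
      constructor
      · intro e
        simp only [Val.ptr.injEq] at e
        obtain ⟨rfl, -, e⟩ := e
        simp_all
      · intro e
        obtain ⟨rfl, rfl⟩ := h.eq_of_addr_eq hg hρ hρ' ho ho' (by omega)
        simp_all

/-- Equality of comparable values is `eq_iff`; in the remaining cases pointer arithmetic only shifts
the offset and integers represent themselves. -/
theorem binop (h : Rep E oom ti g N α Hi Ai ρ Φ l m H A)
    (hg : GoodInit α E.range H₀ Hi Ai) {op : BinOp} {v₁ v₂ v : Val} {w₁ w₂ : ℤ}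
    (h₁ : v₁.Rel α.null ρ w₁) (h₂ : v₂.Rel α.null ρ w₂) (hv : op.eval v₁ v₂ = some v) :
    v.Rel α.null ρ (op.toNotac.eval w₁ w₂) := by
  cases op with
  | eq =>
    by_cases hc : v₁.Comparable ∧ v₂.Comparable
    · have hiff := h.eq_iff hg h₁ h₂ hc.1 hc.2
      have : v = .int (if v₁ = v₂ then 1 else 0) := by
        rw [BinOp.eval_eq] at hv
        split at hv
        · exact hc.1.elim
        · rw [if_pos hc] at hv
          exact (Option.some.inj hv).symm
      subst this
      simp only [Val.Rel, BinOp.toNotac, Notac.BinOp.eval, hiff]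
    · rw [BinOp.eval_eq] at hv
      split at hv
      · obtain rfl := Option.some.inj hv
        simp_all [Val.Rel, BinOp.toNotac, Notac.BinOp.eval]
      · simp [hc] at hv
  | add =>
    cases v₁ <;> cases v₂ <;> simp only [BinOp.eval, Option.some.injEq, reduceCtorEq] at hv <;>
      subst hv
    · simp_all [Val.Rel, BinOp.toNotac, Notac.BinOp.eval]
    · obtain ⟨a, k, j, hρ, rfl, rfl⟩ := h₂
      obtain rfl := h₁
      exact ⟨a, k, j, hρ, rfl, by simp only [BinOp.toNotac, Notac.BinOp.eval]; ring⟩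
    · obtain ⟨a, k, j, hρ, rfl, rfl⟩ := h₁
      obtain rfl := h₂
      exact ⟨a, k, j, hρ, rfl, by simp only [BinOp.toNotac, Notac.BinOp.eval]; ring⟩
  | sub =>
    cases v₁ <;> cases v₂ <;> simp only [BinOp.eval, Option.some.injEq, reduceCtorEq] at hv <;>
      subst hv
    · simp_all [Val.Rel, BinOp.toNotac, Notac.BinOp.eval]
    · obtain ⟨a, k, j, hρ, rfl, rfl⟩ := h₁
      obtain rfl := h₂
      exact ⟨a, k, j, hρ, rfl, by simp only [BinOp.toNotac, Notac.BinOp.eval]; ring⟩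
  | mul =>
    cases v₁ <;> cases v₂ <;> simp only [BinOp.eval, Option.some.injEq, reduceCtorEq] at hv
    subst hv
    simp_all [Val.Rel, BinOp.toNotac, Notac.BinOp.eval]
  | le =>
    cases v₁ <;> cases v₂ <;> simp only [BinOp.eval, Option.some.injEq, reduceCtorEq] at hv
    subst hv
    simp_all [Val.Rel, BinOp.toNotac, Notac.BinOp.eval]

theorem eval (h : Rep E oom ti g N α Hi Ai ρ Φ l m H A)
    (hg : GoodInit α E.range H₀ Hi Ai) {e : Expr} {v : Val} (he : e.eval l = some v) :
    ∃ w, e.toNotac.eval E α.null H = some w ∧ v.Rel α.null ρ w := by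
  induction e generalizing v with
  | var x => exact h.store he
  | const n =>
    obtain rfl := Option.some.inj he
    exact ⟨n, rfl, rfl⟩
  | nil =>
    obtain rfl := Option.some.inj he
    exact ⟨α.null, rfl, rfl⟩
  | binop op e₁ e₂ ih₁ ih₂ =>
    simp only [Expr.eval, Option.bind_eq_some_iff] at he
    obtain ⟨v₁, he₁, v₂, he₂, hv⟩ := he
    obtain ⟨w₁, hw₁, hr₁⟩ := ih₁ he₁
    obtain ⟨w₂, hw₂, hr₂⟩ := ih₂ he₂
    exact ⟨_, by simp [Expr.toNotac, Notac.Expr.eval, hw₁, hw₂], h.binop hg hr₁ hr₂ hv⟩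

theorem mem_dom (h : Rep E oom ti g N α Hi Ai ρ Φ l m H A) (hg : GoodInit α E.range H₀ Hi Ai)
    {x : Var} {a : ℕ} (hx : E x = some a) : a ∈ H.dom :=
  h.tracked.subset_dom hg (.inr ⟨x, hx⟩)

theorem addr_ne (h : Rep E oom ti g N α Hi Ai ρ Φ l m H A) (hg : GoodInit α E.range H₀ Hi Ai)
    {i a k j o b : ℕ} {x : Var} (hρ : ρ i = some (a, k, j)) (ho : o < k) (hx : E x = some b) :
    a + o ≠ b :=
  fun e => h.tracked.notMem_reserved hg (mem_addresses (h.placed hρ) ho) (e ▸ ⟨x, hx⟩)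

theorem heap_set_var (h : Rep E oom ti g N α Hi Ai ρ Φ l m H A)
    (hg : GoodInit α E.range H₀ Hi Ai) {x : Var} {b : ℕ} (hx : E x = some b) (w' : ℤ)
    {i : Ident} {c n : ℤ} {v : Val} (hv : m (i, c, n) = some v) :
    ∃ a k j o w, ρ i = some (a, k, j) ∧ c = (k : ℤ) ∧
      n = (o : ℕ) ∧ o < k ∧ H.set b w' (a + o) = some w ∧ v.Rel α.null ρ w := by
  obtain ⟨a, k, j, o, w, hρ, hb, hn, ho, hw, hr⟩ := h.heap hv
  exact ⟨a, k, j, o, w, hρ, hb, hn, ho,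
    by rw [FinPMap.set_of_ne _ _ (h.addr_ne hg hρ ho hx), hw], hr⟩

theorem set_var (hL : Layout E oom ti g N) (h : Rep E oom ti g N α Hi Ai ρ Φ l m H A)
    (hg : GoodInit α E.range H₀ Hi Ai) {x : Var} {a : ℕ} {v : Val} {w : ℤ}
    (hx : Admissible E oom ti g N x) (ha : E x = some a) (hv : v.Rel α.null ρ w) :
    Rep E oom ti g N α Hi Ai ρ Φ (l.set x v) m (H.set a w) A where
  tracked := h.tracked.set w (.inr ⟨x, ha⟩) (h.mem_dom hg ha)
  placed := h.placed
  separate := h.separate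
  store {y u} hu := by
    by_cases hy : y = x
    · subst hy
      obtain rfl : v = u := by simpa using hu
      exact ⟨w, Env.lookup_set_self ha _ _, hv⟩
    · rw [FinPMap.set_of_ne _ _ hy] at hu
      rw [Env.lookup_set_of_ne hL.inj ha hy]
      exact h.store hu
  heap := h.heap_set_var hg ha w
  oom_eq := by rw [Env.lookup_set_of_ne hL.inj ha hx.ne_oom.symm, h.oom_eq]
  ti_eq := by rw [Env.lookup_set_of_ne hL.inj ha hx.ne_ti.symm, h.ti_eq]
  unused j hj := by rw [FinPMap.set_of_ne _ _ (hx.ne_g j hj).symm, h.unused j hj]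

theorem set_guard (hL : Layout E oom ti g N) (h : Rep E oom ti g N α Hi Ai ρ Φ l m H A)
    (hg : GoodInit α E.range H₀ Hi Ai) {s a : ℕ} (hs : s < N) (ha : E (g s) = some a) (w : ℤ) :
    Rep E oom ti g N α Hi Ai ρ Φ l m (H.set a w) A where
  tracked := h.tracked.set w (.inr ⟨_, ha⟩) (h.mem_dom hg ha)
  placed := h.placed
  separate := h.separate
  store {y u} hu := by
    -- The store is undefined at guard variables, so a guard may be overwritten without changing
    -- what is represented.
    have hy : y ≠ g s := by
      rintro rfl
      simp [h.unused s hs] at hu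
    rw [Env.lookup_set_of_ne hL.inj ha hy]
    exact h.store hu
  heap := h.heap_set_var hg ha w
  oom_eq := by rw [Env.lookup_set_of_ne hL.inj ha (hL.g_ne_oom s hs).symm, h.oom_eq]
  ti_eq := by rw [Env.lookup_set_of_ne hL.inj ha (hL.g_ne_ti s hs).symm, h.ti_eq]
  unused := h.unused

theorem lookup_set_addr {a : ℕ} (ha : a ∉ E.range) (w : ℤ) (x : Var) :
    E.lookup (H.set a w) x = E.lookup H x :=
  Env.lookup_congr (fun _ hb => FinPMap.set_of_ne _ _ (ne_of_mem_of_not_mem hb ha)) x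

theorem set_block (h : Rep E oom ti g N α Hi Ai ρ Φ l m H A) (hg : GoodInit α E.range H₀ Hi Ai)
    {i a k j o : ℕ} {v : Val} {w : ℤ} (hρ : ρ i = some (a, k, j)) (ho : o < k)
    (hv : v.Rel α.null ρ w) :
    Rep E oom ti g N α Hi Ai ρ Φ l (m.set (i, (k : ℤ), (o : ℤ)) v) (H.set (a + o) w) A := by
  have hmem := mem_addresses (h.placed hρ) ho
  have hR := h.tracked.notMem_reserved hg hmem
  refine ⟨h.tracked.set w (.inl hmem) (h.tracked.subset_dom hg (.inl hmem)), h.placed, h.separate,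
    fun hu => ?_, fun {i' b' n' v'} hu => ?_, ?_, ?_, h.unused⟩
  · rw [lookup_set_addr hR]
    exact h.store hu
  · by_cases hq : (i', b', n') = (i, (k : ℤ), (o : ℤ))
    · obtain ⟨rfl, rfl, rfl⟩ : i' = i ∧ b' = k ∧ n' = o := by simpa using hq
      obtain rfl : v = v' := by simpa using hu
      exact ⟨a, k, j, o, w, hρ, rfl, rfl, ho, by simp, hv⟩
    · rw [FinPMap.set_of_ne _ _ hq] at hu
      obtain ⟨a', k', j', o', w', hρ', rfl, rfl, ho', hw', hr⟩ := h.heap hu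
      refine ⟨a', k', j', o', w', hρ', rfl, rfl, ho', ?_, hr⟩
      rw [FinPMap.set_of_ne _ _ ?_, hw']
      intro e
      -- Another Memsafe cell at the overwritten address would be the same cell: no aliasing.
      obtain ⟨rfl, rfl⟩ := h.eq_of_addr_eq hg hρ' hρ ho' ho e
      obtain ⟨-, rfl, -⟩ : a' = a ∧ k' = k ∧ j' = j := by simpa [hρ] using hρ'.symm
      exact hq rfl
  · rw [lookup_set_addr hR, h.oom_eq]
  · rw [lookup_set_addr hR, h.ti_eq]

end Rep

/-! ## Runs without memory -/

theorem Exhausted.guard (h : Exhausted E oom H) (c : Notac.Cmd) :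
    Steps E α (some (memGuard oom c)) H A [] none H A := by
  obtain ⟨v, hv, ho⟩ := h.oom_ne
  exact .ite_true ho hv .skip

theorem Exhausted.set (hL : Layout E oom ti g N) (h : Exhausted E oom H) {s a : ℕ} (hs : s < N)
    (ha : E (g s) = some a) (v : ℤ) : Exhausted E oom (H.set a v) := by
  obtain ⟨w, hw, ho⟩ := h.oom_ne
  refine ⟨?_, w, hw, ?_⟩
  · have := FinPMap.dom_set_of_mem v (h.compatible ⟨_, ha⟩)
    unfold Env.Compatible
    rw [this]
    exact h.compatible
  · rw [Env.lookup_set_of_ne hL.inj ha (hL.g_ne_oom s hs).symm, ho]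

/-- Each guarded command takes the `skip` branch. A loop sets its guard to `(oom == 0)`, that is to
0, and leaves at once; only guard variables change, and the allocator is never called. -/
theorem Exhausted.steps (hL : Layout E oom ti g N) (c : Cmd) (s : ℕ) (hs : s + c.numLoops ≤ N)
    (h : Exhausted E oom H) :
    ∃ H', Steps E α (some (c.toNotac oom ti g s)) H A [] none H' A ∧ Exhausted E oom H' := by
  induction c generalizing s H with
  | skip => exact ⟨H, .skip, h⟩
  | seq c₁ c₂ ih₁ ih₂ =>
    simp only [Cmd.numLoops] at hs
    obtain ⟨H₁, hs₁, h₁⟩ := ih₁ s (by omega) h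
    obtain ⟨H₂, hs₂, h₂⟩ := ih₂ (s + c₁.numLoops) (by omega) h₁
    exact ⟨H₂, hs₁.seq_silent hs₂, h₂⟩
  | loop e c =>
    simp only [Cmd.numLoops] at hs
    obtain ⟨a, ha⟩ := Env.exists_of_mem_dom (hL.g_mem s (by omega))
    obtain ⟨v, hv, ho⟩ := h.oom_ne
    refine ⟨H.set a 0, ?_, h.set hL (by omega) ha 0⟩
    refine (Steps.assignVar ha ?_ (h.compatible ⟨_, ha⟩)).seq_silent
      (.loop_false (Env.lookup_set_self ha _ _))
    simp [Notac.Expr.eval, ho, Notac.BinOp.eval, hv]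
  | _ => exact ⟨H, h.guard _, h⟩

end

/-! ## Simulation -/

/-- Under every strategy, the translation of `c` simulates the run of `c` from `l, m` to `l', m'`
until an allocation fails, and requests allocations of the same sizes `ns`. -/
def Simulates (E : Env) (oom ti : Var) (g : ℕ → Var) (N : ℕ) (c : Cmd) (l : Store) (m : Heap)
    (l' : Store) (m' : Heap) (ns : List ℕ) : Prop :=
  ∀ (α : AllocStrategy.{u}) (H₀ Hi : Mem) (Ai : α.State), GoodInit α E.range H₀ Hi Ai →
    ∀ s, s + c.numLoops ≤ N → ∀ ρ Φ H A, Rep E oom ti g N α Hi Ai ρ Φ l m H A →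
      ∃ t H' A', Steps E α (some (c.toNotac oom ti g s)) H A t none H' A' ∧
        ((t.map Notac.Event.symb? = successes ns ∧
            (∃ ρ' Φ', Rep E oom ti g N α Hi Ai ρ' Φ' l' m' H' A') ∧
            ∀ j < N, j < s ∨ s + c.numLoops ≤ j → E.lookup H' (g j) = E.lookup H (g j)) ∨
          FailsAlong ns (t.map Notac.Event.symb?) ∧ Exhausted E oom H')

section

variable {E : Env} {oom ti : Var} {g : ℕ → Var} {N : ℕ} {α : AllocStrategy.{u}} {H₀ Hi : Mem}
  {Ai A : α.State} {ρ : Placement} {Φ : AllocMap} {l : Store} {m : Heap} {H : Mem}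

theorem Rep.guard (h : Rep E oom ti g N α Hi Ai ρ Φ l m H A) {c : Notac.Cmd} {t : Notac.Trace}
    {r : Option Notac.Cmd} {H' : Mem} {A' : α.State} (hc : Steps E α (some c) H A t r H' A') :
    Steps E α (some (memGuard oom c)) H A t r H' A' :=
  .ite_false h.oom_eq hc

/-! ### Simulation of allocation -/

theorem zeroLoop_steps (hE : E.Inj) (hg : GoodInit α E.range H₀ Hi Ai) {x : Var} {a b : ℕ}
    (hb : E ti = some b) (hx : x ≠ ti) (k : ℕ) (hT : Tracked α E.range Hi Ai Φ H A)
    (hxa : E.lookup H x = some (a : ℤ)) (hk : E.lookup H ti = some (k : ℤ))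
    (ha : ∀ o < k, a + o ∈ Φ.addresses) :
    ∃ H', Steps E α (some (.loop (.binop .gt (.var ti) (.const 0))
        (.seq (.assign (.var ti) (.binop .sub (.var ti) (.const 1)))
          (.assign (.deref (.binop .add (.var x) (.var ti))) (.const 0))))) H A [] none H' A ∧
      Tracked α E.range Hi Ai Φ H' A ∧ E.lookup H' ti = some 0 ∧ (∀ o < k, H' (a + o) = some 0) ∧
      ∀ q, q ≠ b → (∀ o < k, q ≠ a + o) → H' q = H q := by
  -- The block is cleared from the top down, and `k` is the current value of `ti`. As `ti` need not
  -- be 0 here, `Rep` is not available and only `Tracked` is maintained.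
  induction k generalizing H with
  | zero =>
    refine ⟨H, .loop_false ?_, hT, by simpa using hk, by simp, fun _ _ _ => rfl⟩
    simp [Notac.Expr.eval, Notac.BinOp.eval, hk]
  | succ k ih =>
    have hbR : b ∈ E.range := ⟨_, hb⟩
    have hbd : b ∈ H.dom := hT.subset_dom hg (.inr hbR)
    have hT₁ := hT.set (k : ℤ) (.inr hbR) hbd
    have hk₁ := Env.lookup_set_self hb H (k : ℤ)
    have hx₁ : E.lookup (H.set b k) x = some (a : ℤ) := by
      rw [Env.lookup_set_of_ne hE hb hx, hxa]
    have hak := ha k (by omega)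
    have hakR := hT.notMem_reserved hg hak
    have hakd := hT₁.subset_dom hg (.inl hak)
    have hT₂ := hT₁.set 0 (.inl hak) hakd
    obtain ⟨H', hs, hT', hti, hz, hq⟩ := ih hT₂ (by rw [Rep.lookup_set_addr hakR, hx₁])
      (by rw [Rep.lookup_set_addr hakR, hk₁]) (fun o ho => ha o (by omega))
    refine ⟨H', ?_, hT', hti, fun o ho => ?_, fun q hqb hqo => ?_⟩
    · refine Steps.loop_true (t := []) (v := 1) ?_ one_ne_zero
        ((Steps.assignVar hb ?_ hbd).seq_silent (.silent (.assign ?_ rfl hakd) .refl)) hs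
      · simp only [Notac.Expr.eval, hk, Notac.BinOp.eval, Option.bind_some]
        rw [if_pos (by positivity)]
      · simp [Notac.Expr.eval, hk, Notac.BinOp.eval]
      · simp only [Notac.LVal.eval, Notac.Expr.eval, hk₁, hx₁, Notac.BinOp.eval, Option.bind_some]
        exact_mod_cast Notac.toAddr_natCast (a + k)
    · by_cases hok : o = k
      · subst hok
        rw [hq (a + o) (ne_of_mem_of_not_mem hbR hakR).symm (fun o' ho' => by omega)]
        simp
      · exact hz o (by omega)
    · rw [hq q hqb (fun o ho => hqo o (by omega)), FinPMap.set_of_ne _ _ (hqo k (by omega)),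
        FinPMap.set_of_ne _ _ hqb]

/-- A fresh identifier may still have an old placement, namely that of an empty block to which no
pointer is left. Replacing it is harmless for values that do not mention the identifier. -/
theorem Val.Rel.update {null : ℕ} {v : Val} {w : ℤ} (h : v.Rel null ρ w) {i : Ident}
    (hi : ∀ b n, v ≠ .ptr i b n) (p : Option (ℕ × ℕ × ℕ)) :
    v.Rel null (Function.update ρ i p) w := by
  cases v with
  | int => exact h
  | nil => exact h
  | ptr i' b n =>
    obtain ⟨a, k, j, hρ, h⟩ := h
    refine ⟨a, k, j, ?_, h⟩
    rw [Function.update_of_ne ?_, hρ]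
    rintro rfl
    exact hi b n rfl

theorem Rep.alloc (hL : Layout E oom ti g N) (h : Rep E oom ti g N α Hi Ai ρ Φ l m H A)
    {x : Var} {k a j : ℕ} {i : Ident} {H' : Mem} {A' : α.State}
    (hx : Admissible E oom ti g N x) (hi : i ∉ ids l m) (hj : ∀ b n, (b, n, j) ∉ Φ)
    (hT : Tracked α E.range Hi Ai (Φ ∪ {(a, k, j)}) H' A')
    (hkeep : ∀ q ∈ Φ.addresses, H' q = H q)
    (hxa : E.lookup H' x = some (a : ℤ)) (hti : E.lookup H' ti = some 0)
    (hvar : ∀ y, y ≠ x → y ≠ ti → E.lookup H' y = E.lookup H y)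
    (hz : ∀ o < k, H' (a + o) = some 0) :
    Rep E oom ti g N α Hi Ai (Function.update ρ i (some (a, k, j))) (Φ ∪ {(a, k, j)})
      (l.set x (.ptr i k 0)) (m.setOn (block i k) (.int 0)) H' A' := by
  have hnew : ∀ {i' b n c}, i' ≠ i → Function.update ρ i (some (a, k, j)) i' = some (b, n, c) →
      ρ i' = some (b, n, c) := fun hne h => by rwa [Function.update_of_ne hne] at h
  refine ⟨hT, fun {i' b n c} hρ => ?_, fun {i₁ i₂ b₁ b₂ n₁ n₂ c} h₁ h₂ => ?_, fun {y v} hv => ?_,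
    fun {i' b n v} hv => ?_, ?_, hti, fun s hs => ?_⟩
  · by_cases hi' : i' = i
    · subst hi'
      simp only [Function.update_self, Option.some.injEq] at hρ
      exact .inr hρ.symm
    · exact .inl (h.placed (hnew hi' hρ))
  · have key : ∀ {i' b n b' n'}, i' ≠ i →
        Function.update ρ i (some (a, k, j)) i' = some (b, n, c) →
        Function.update ρ i (some (a, k, j)) i = some (b', n', c) → False := by
      intro i' b n b' n' hne h h'
      simp only [Function.update_self, Option.some.injEq, Prod.mk.injEq] at h'
      obtain ⟨-, -, rfl⟩ := h'
      exact hj _ _ (Rep.placed ‹_› (hnew hne h))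
    by_cases e₁ : i₁ = i
    · by_cases e₂ : i₂ = i
      · rw [e₁, e₂]
      · subst e₁
        exact (key e₂ h₂ h₁).elim
    · by_cases e₂ : i₂ = i
      · subst e₂
        exact (key e₁ h₁ h₂).elim
      · exact h.separate (hnew e₁ h₁) (hnew e₂ h₂)
  · by_cases hy : y = x
    · subst hy
      obtain rfl : Val.ptr i k 0 = v := by simpa using hv
      exact ⟨a, hxa, a, k, j, by simp, rfl, by simp⟩
    · rw [FinPMap.set_of_ne _ _ hy] at hv
      obtain ⟨w, hw, hr⟩ := h.store hv
      refine ⟨w, ?_, hr.update (fun b n e => hi ⟨b, n, .inl ⟨y, e ▸ hv⟩⟩) _⟩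
      -- The store may be defined at `ti`; its value is still represented because the clearing loop
      -- ends with `ti` back at 0.
      by_cases hyt : y = ti
      · subst hyt
        rw [hti, ← hw, h.ti_eq]
      · rw [hvar y hy hyt, hw]
  · simp only [FinPMap.setOn] at hv
    split_ifs at hv with hmem
    · obtain rfl := Option.some.inj hv
      simp only [block, Finset.mem_image, Finset.mem_Ico, Prod.mk.injEq] at hmem
      obtain ⟨o, ⟨h0, ho⟩, rfl, rfl, rfl⟩ := hmem
      lift o to ℕ using h0
      exact ⟨a, k, j, o, 0, by simp, rfl, rfl, by omega, hz o (by omega), rfl⟩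
    · obtain ⟨a', k', j', o, w, hρ, rfl, rfl, ho, hw, hr⟩ := h.heap hv
      have hii : i' ≠ i := by
        rintro rfl
        -- A cell of an older block has an identifier that occurs in the state, hence not the fresh
        -- one.
        exact hi ⟨_, _, .inr (.inl (FinPMap.mem_dom_of_eq hv))⟩
      refine ⟨a', k', j', o, w, by rw [Function.update_of_ne hii, hρ], rfl, rfl, ho, ?_,
        hr.update (fun b n e => hi ⟨b, n, .inr (.inr ⟨_, e ▸ hv⟩)⟩) _⟩
      rw [hkeep _ (mem_addresses (h.placed hρ) ho), hw]
  · rw [hvar oom hx.ne_oom.symm hL.oom_ne_ti, h.oom_eq]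
  · rw [FinPMap.set_of_ne _ _ (hx.ne_g s hs).symm, h.unused s hs]

theorem simulates_alloc (hL : Layout E oom ti g N) {x : Var} {e : Expr} {k : ℕ} {i : Ident}
    (hx : Admissible E oom ti g N x) (he : e.eval l = some (.int k)) (hi : i ∉ ids l m) :
    Simulates.{u} E oom ti g N (.alloc x e) l m (l.set x (.ptr i k 0))
      (m.setOn (block i k) (.int 0)) [k] := by
  intro α H₀ Hi Ai hg s hs ρ Φ H A h
  obtain ⟨w, hw, rfl⟩ := h.eval hg he
  obtain ⟨b, hb⟩ := Env.exists_of_mem_dom hL.ti_mem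
  obtain ⟨q, hq⟩ := Env.exists_of_mem_dom hx.mem
  obtain ⟨d, hd⟩ := Env.exists_of_mem_dom hL.oom_mem
  have hbR : b ∈ E.range := ⟨_, hb⟩
  have hqR : q ∈ E.range := ⟨_, hq⟩
  have hdR : d ∈ E.range := ⟨_, hd⟩
  have hT₁ := h.tracked.set (k : ℤ) (.inr hbR) (h.mem_dom hg hb)
  have hassign : Steps E α (some (.assign (.var ti) e.toNotac)) H A [] none (H.set b k) A :=
    .assignVar hb hw (h.mem_dom hg hb)
  have hev : (Notac.Expr.var ti).eval E α.null (H.set b k) = some (k : ℤ) :=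
    Env.lookup_set_self hb _ _
  have hlv : (Notac.LVal.var x).eval E α.null (H.set b k) = some q := hq
  obtain ⟨H₂, A₂, a, hm⟩ : ∃ H₂ A₂ a, α.malloc (H.set b k) A k = (H₂, A₂, a) := ⟨_, _, _, rfl⟩
  -- On failure `x` receives null, the test succeeds and `oom` is set, so only compatibility has to
  -- survive; on success the new block is cleared and the representation extended.
  by_cases ha : a = α.null
  · obtain ⟨hT₂, -⟩ := hT₁.mallocFail hg hm ha
    have hq₂ : q ∈ H₂.dom := hT₂.subset_dom hg (.inr hqR)
    have hT₃ := hT₂.set (a : ℤ) (.inr hqR) hq₂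
    have hd₃ := hT₃.subset_dom hg (.inr hdR)
    have hT₄ := hT₃.set 1 (.inr hdR) hd₃
    refine ⟨[.mallocFail k], (H₂.set q a).set d 1, A₂, h.guard ?_, .inr ⟨?_, ?_⟩⟩
    · refine hassign.seq_silent ((Steps.single (.mallocFail hev hm hlv hq₂ ha)).seq (t' := [])
        (.ite_true (v := 1) ?_ one_ne_zero (.assignVar hd rfl hd₃)))
      simp [Notac.Expr.eval, Notac.BinOp.eval, Env.lookup_set_self hq, ha]
    · exact ⟨[], k, [], rfl, rfl⟩
    · exact ⟨fun y hy => hT₄.subset_dom hg (.inr hy), 1, one_ne_zero, Env.lookup_set_self hd _ _⟩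
  · obtain ⟨j, hT₂, hj, hkeep⟩ := hT₁.mallocOk hg hm ha
    have hq₂ : q ∈ H₂.dom := hT₂.subset_dom hg (.inr hqR)
    have hT₃ := hT₂.set (a : ℤ) (.inr hqR) hq₂
    -- The size in `ti` survives the call because the allocator does not touch reserved memory.
    have hk₃ : E.lookup (H₂.set q a) ti = some (k : ℤ) := by
      rw [Env.lookup_set_of_ne hL.inj hq hx.ne_ti.symm,
        ← Env.lookup_congr (fun y hy => hkeep y (.inr hy)), Env.lookup_set_self hb]
    have hnew : ∀ o < k, a + o ∈ AllocMap.addresses (Φ ∪ {(a, k, j)}) :=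
      fun o ho => mem_addresses (.inr rfl) ho
    obtain ⟨H₄, hs₄, hT₄, hti, hz, hrest⟩ := zeroLoop_steps hL.inj hg hb hx.ne_ti k hT₃
      (Env.lookup_set_self hq _ _) hk₃ hnew
    have hnewR : ∀ {y}, y ∈ E.range → ∀ o < k, y ≠ a + o := fun hy o ho e =>
      hT₃.notMem_reserved hg (hnew o ho) (e ▸ hy)
    have hvar : ∀ y, y ≠ x → y ≠ ti → E.lookup H₄ y = E.lookup H y := by
      intro y hyx hyt
      unfold Env.lookup
      cases hy : E y with
      | none => rfl
      | some p =>
        have hpb : p ≠ b := fun e => hyt (hL.inj _ _ _ hy (e ▸ hb))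
        have hpq : p ≠ q := fun e => hyx (hL.inj _ _ _ hy (e ▸ hq))
        simp only [Option.bind_some]
        rw [hrest p hpb (hnewR ⟨_, hy⟩), FinPMap.set_of_ne _ _ hpq, ← hkeep p (.inr ⟨_, hy⟩),
          FinPMap.set_of_ne _ _ hpb]
    refine ⟨[.malloc k a], H₄, A₂, h.guard ?_, .inl ⟨rfl, ⟨_, _, h.alloc hL hx hi hj hT₄ ?_ ?_ hti
      hvar hz⟩, fun s hs _ => hvar _ (hx.ne_g s hs).symm (hL.g_ne_ti s hs)⟩⟩
    · refine hassign.seq_silent ((Steps.single (.mallocOk hev hm hlv hq₂ ha)).seq (t' := [])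
        (.ite_false ?_ hs₄))
      simp [Notac.Expr.eval, Notac.BinOp.eval, Env.lookup_set_self hq, ha]
    · intro p hp
      have hpR := h.tracked.notMem_reserved hg hp
      have hpb := (ne_of_mem_of_not_mem hbR hpR).symm
      have hpq := (ne_of_mem_of_not_mem hqR hpR).symm
      rw [hrest p hpb ?_, FinPMap.set_of_ne _ _ hpq, ← hkeep p (.inl hp),
        FinPMap.set_of_ne _ _ hpb]
      rintro o ho rfl
      obtain ⟨a', k', j', hΦ, h₁, h₂⟩ := hp
      -- The clearing loop spares older blocks: the new region has a new index, hence is disjoint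
      -- from theirs.
      refine Set.disjoint_left.1 (hT₃.disjoint hg (.inl hΦ) (.inr rfl)
        (fun e => hj a' k' (e ▸ hΦ))) ⟨h₁, h₂⟩ ⟨?_, ?_⟩ <;> omega
    · unfold Env.lookup
      rw [hq, Option.bind_some, hrest q (fun e => hx.ne_ti (hL.inj _ _ _ hq (e ▸ hb))) (hnewR hqR)]
      simp

/-! ### Simulation of sequencing and loops -/

theorem Simulates.seq (hL : Layout E oom ti g N) {c₁ c₂ : Cmd} {l' l'' : Store} {m' m'' : Heap}
    {ns₁ ns₂ : List ℕ} (h₁ : Simulates.{u} E oom ti g N c₁ l m l' m' ns₁)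
    (h₂ : Simulates.{u} E oom ti g N c₂ l' m' l'' m'' ns₂) :
    Simulates.{u} E oom ti g N (.seq c₁ c₂) l m l'' m'' (ns₁ ++ ns₂) := by
  intro α H₀ Hi Ai hg s hs ρ Φ H A h
  simp only [Cmd.numLoops] at hs ⊢
  obtain ⟨t₁, H₁, A₁, hs₁, ⟨ht₁, ⟨ρ₁, Φ₁, hr₁⟩, hk₁⟩ | ⟨ht₁, hx₁⟩⟩ :=
    h₁ α H₀ Hi Ai hg s (by omega) _ _ _ _ h
  · obtain ⟨t₂, H₂, A₂, hs₂, ⟨ht₂, hr₂, hk₂⟩ | ⟨ht₂, hx₂⟩⟩ :=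
      h₂ α H₀ Hi Ai hg (s + c₁.numLoops) (by omega) _ _ _ _ hr₁
    · refine ⟨_, _, _, hs₁.seq hs₂, .inl ⟨by simp [ht₁, ht₂, successes], hr₂, fun j hj hjs => ?_⟩⟩
      rw [hk₂ j hj (by omega), hk₁ j hj (by omega)]
    · refine ⟨_, _, _, hs₁.seq hs₂, .inr ⟨?_, hx₂⟩⟩
      rw [List.map_append, ht₁]
      exact ht₂.append_left _
  · obtain ⟨H₂, hs₂, hx₂⟩ := hx₁.steps (α := α) (A := A₁) hL c₂ (s + c₁.numLoops) (by omega)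
    refine ⟨_, _, _, hs₁.seq hs₂, .inr ⟨?_, hx₂⟩⟩
    simpa using ht₁.append_right ns₂

/-- The body of the translation of a loop, with guard variable `γ`. -/
def loopBody (oom γ : Var) (e : Notac.Expr) (c : Notac.Cmd) : Notac.Cmd :=
  .seq (.ite e c (.assign (.var γ) (.const 0)))
    (.assign (.var γ) (.binop .mul (.binop .eq (.var oom) (.const 0)) (.var γ)))

/-- The initialisation of the guard variable `γ` of a loop. -/
def loopInit (oom γ : Var) : Notac.Cmd :=
  .assign (.var γ) (.binop .eq (.var oom) (.const 0))

theorem Rep.loopInit_steps (h : Rep E oom ti g N α Hi Ai ρ Φ l m H A)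
    (hg : GoodInit α E.range H₀ Hi Ai) {γ : Var} {a : ℕ} (ha : E γ = some a) :
    Steps E α (some (loopInit oom γ)) H A [] none (H.set a 1) A := by
  refine .assignVar ha ?_ (h.mem_dom hg ha)
  simp [Notac.Expr.eval, h.oom_eq, Notac.BinOp.eval]

/-- As `oom` is 0, the guard is multiplied by 1. The write then restores the same heap, so the
representation persists trivially. -/
theorem Rep.guardUpdate_steps (h : Rep E oom ti g N α Hi Ai ρ Φ l m H A)
    (hg : GoodInit α E.range H₀ Hi Ai) {γ : Var} {a : ℕ} (ha : E γ = some a) {v : ℤ}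
    (hv : E.lookup H γ = some v) :
    Steps E α (some (.assign (.var γ) (.binop .mul (.binop .eq (.var oom) (.const 0)) (.var γ))))
      H A [] none H A := by
  have hav : H a = some v := by simpa [Env.lookup, ha] using hv
  have := Steps.assignVar (E := E) (α := α) (A := A) (v := v)
    (e := .binop .mul (.binop .eq (.var oom) (.const 0)) (.var γ)) ha
    (by simp [Notac.Expr.eval, h.oom_eq, Notac.BinOp.eval, hv]) (h.mem_dom hg ha)
  rwa [FinPMap.set_eq_self hav] at this

theorem Exhausted.guardUpdate_steps (h : Exhausted E oom H) {γ : Var} {a : ℕ} (ha : E γ = some a) :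
    Steps E α (some (.assign (.var γ) (.binop .mul (.binop .eq (.var oom) (.const 0)) (.var γ))))
      H A [] none (H.set a 0) A := by
  have had : a ∈ H.dom := h.compatible ⟨_, ha⟩
  obtain ⟨w, hw⟩ := FinPMap.exists_of_mem_dom had
  obtain ⟨v, hv, ho⟩ := h.oom_ne
  have hγ : E.lookup H γ = some w := by simpa [Env.lookup, ha] using hw
  refine .assignVar ha ?_ had
  simp [Notac.Expr.eval, ho, hv, Notac.BinOp.eval, hγ]

theorem simulates_loopFalse (hL : Layout E oom ti g N) {e : Expr} {c : Cmd}
    (he : e.eval l = some (.int 0)) : Simulates.{u} E oom ti g N (.loop e c) l m l m [] := by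
  intro α H₀ Hi Ai hg s hs ρ Φ H A h
  simp only [Cmd.numLoops] at hs ⊢
  obtain ⟨a, ha⟩ := Env.exists_of_mem_dom (hL.g_mem s (by omega))
  have h₁ := h.set_guard hL hg (by omega) ha 1
  have h₂ := h₁.set_guard hL hg (by omega) ha 0
  obtain ⟨w, hw, rfl⟩ := h₁.eval hg he
  have hself := Env.lookup_set_self ha (H.set a 1) 0
  refine ⟨[], (H.set a 1).set a 0, A, ?_, .inl ⟨rfl, ⟨ρ, Φ, h₂⟩, fun j hj hjs => ?_⟩⟩
  · refine (h.loopInit_steps hg ha).seq_silent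
      -- The guard starts at 1, so the body is entered once even if the condition is false at the
      -- outset; the condition is tested inside and resets the guard.
      (.loop_true (t := []) (c := loopBody oom (g s) e.toNotac (c.toNotac oom ti g (s + 1)))
        (Env.lookup_set_self ha _ _) one_ne_zero ?_ (.loop_false hself))
    exact Steps.seq_silent (.ite_false hw (.assignVar ha rfl (h₁.mem_dom hg ha)))
      (h₂.guardUpdate_steps hg ha hself)
  · have hne : g j ≠ g s := fun e => by
      have := hL.g_injOn (show j ∈ {j | j < N} from hj) (show s < N by omega) e
      omega
    rw [Env.lookup_set_of_ne hL.inj ha hne, Env.lookup_set_of_ne hL.inj ha hne]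

/-- The hypothesis on the remaining iterations concerns the whole translated loop, including the
initialisation of the guard, which is not executed again. After a successful iteration the guard
still holds 1, so that initialisation would change nothing and can be removed from the run. -/
theorem Simulates.loopTrue (hL : Layout E oom ti g N) {e : Expr} {c : Cmd} {n : ℤ}
    {l' l'' : Store} {m' m'' : Heap} {ns₁ ns₂ : List ℕ} (he : e.eval l = some (.int n))
    (hn : n ≠ 0) (h₁ : Simulates.{u} E oom ti g N c l m l' m' ns₁)
    (h₂ : Simulates.{u} E oom ti g N (.loop e c) l' m' l'' m'' ns₂) :
    Simulates.{u} E oom ti g N (.loop e c) l m l'' m'' (ns₁ ++ ns₂) := by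
  intro α H₀ Hi Ai hg s hs ρ Φ H A h
  have hs' := hs
  simp only [Cmd.numLoops] at hs ⊢
  have hsN : s < N := by omega
  obtain ⟨a, ha⟩ := Env.exists_of_mem_dom (hL.g_mem s hsN)
  have hr := h.set_guard hL hg hsN ha 1
  obtain ⟨w, hw, rfl⟩ := hr.eval hg he
  have hinit := h.loopInit_steps hg ha
  obtain ⟨t₁, H₁, A₁, hs₁, ⟨ht₁, ⟨ρ₁, Φ₁, hr₁⟩, hk₁⟩ | ⟨ht₁, hx₁⟩⟩ :=
    h₁ α H₀ Hi Ai hg (s + 1) (by omega) _ _ _ _ hr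
  · have hg₁ : E.lookup H₁ (g s) = some 1 := by
      -- Loops in the body are numbered from `s + 1`, so the body leaves the guard `g s` alone.
      rw [hk₁ s hsN (by omega), Env.lookup_set_self ha]
    have ha₁ : H₁ a = some 1 := by simpa [Env.lookup, ha] using hg₁
    obtain ⟨t₂, H₂, A₂, hs₂, hres⟩ := h₂ α H₀ Hi Ai hg s hs' _ _ _ _ hr₁
    have hloop : Steps E α
        (some (.loop (.var (g s)) (loopBody oom (g s) e.toNotac (c.toNotac oom ti g (s + 1)))))
        H₁ A₁ t₂ none H₂ A₂ := by
      -- Determinism splits the run given by `h₂` after the initialisation, whose write of 1 is void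
      -- by `ha₁`.
      obtain ⟨t, ht, hrun⟩ := ((hr₁.loopInit_steps hg ha).seq_silent .refl).prefix_of_terminal hs₂
      rw [FinPMap.set_eq_self ha₁] at hrun
      obtain rfl : t₂ = t := ht
      exact hrun
    have hbody : Steps E α (some (loopBody oom (g s) e.toNotac (c.toNotac oom ti g (s + 1))))
        (H.set a 1) A t₁ none H₁ A₁ := by
      simpa [loopBody] using Steps.seq (.ite_true hw hn hs₁) (hr₁.guardUpdate_steps hg ha hg₁)
    refine ⟨t₁ ++ t₂, H₂, A₂, hinit.seq_silent
      (.loop_true (Env.lookup_set_self ha _ _) one_ne_zero hbody hloop), ?_⟩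
    rcases hres with ⟨ht₂, hr₂, hk₂⟩ | ⟨ht₂, hx₂⟩
    · refine .inl ⟨by simp [ht₁, ht₂, successes], hr₂, fun j hj hjs => ?_⟩
      have hne : g j ≠ g s := fun e => by
        have := hL.g_injOn (show j ∈ {j | j < N} from hj) (show s < N by omega) e
        omega
      rw [hk₂ j hj hjs, hk₁ j hj (by omega), Env.lookup_set_of_ne hL.inj ha hne]
    · refine .inr ⟨?_, hx₂⟩
      rw [List.map_append, ht₁]
      exact ht₂.append_left _
  · refine ⟨t₁, H₁.set a 0, A₁, ?_, .inr ⟨ht₁.append_right _, hx₁.set hL hsN ha 0⟩⟩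
    have hbody : Steps E α (some (loopBody oom (g s) e.toNotac (c.toNotac oom ti g (s + 1))))
        (H.set a 1) A t₁ none (H₁.set a 0) A₁ := by
      simpa [loopBody] using Steps.seq (.ite_true hw hn hs₁) (hx₁.guardUpdate_steps ha)
    have hloop := Steps.loop_true (e := .var (g s)) (Env.lookup_set_self ha _ _) one_ne_zero hbody
      (.loop_false (Env.lookup_set_self ha _ _))
    rw [List.append_nil] at hloop
    exact hinit.seq_silent hloop

/-- The sizes are collected along the Memsafe derivation, before any strategy is chosen; this order
of quantifiers is what yields independence. -/
theorem exists_simulates (hL : Layout E oom ti g N) {c : Cmd} {l' : Store} {m' : Heap}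
    (h : Eval c l m l' m') (hc : ∀ x ∈ c.vars, Admissible E oom ti g N x) :
    ∃ ns, Simulates.{u} E oom ti g N c l m l' m' ns := by
  induction h with
  | skip =>
    exact ⟨[], fun α H₀ Hi Ai hg s hs ρ Φ H A h =>
      ⟨[], H, A, .skip, .inl ⟨rfl, ⟨ρ, Φ, h⟩, fun _ _ _ => rfl⟩⟩⟩
  | seq _ _ ih₁ ih₂ =>
    obtain ⟨ns₁, h₁⟩ := ih₁ fun x hx => hc x (.inl hx)
    obtain ⟨ns₂, h₂⟩ := ih₂ fun x hx => hc x (.inr hx)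
    exact ⟨_, h₁.seq hL h₂⟩
  | iteTrue he hn _ ih =>
    obtain ⟨ns, hs⟩ := ih fun x hx => hc x (.inl (.inr hx))
    refine ⟨ns, fun α H₀ Hi Ai hg s hs' ρ Φ H A h => ?_⟩
    simp only [Cmd.numLoops] at hs' ⊢
    obtain ⟨w, hw, rfl⟩ := h.eval hg he
    obtain ⟨t, H', A', hrun, hres⟩ := hs α H₀ Hi Ai hg s (by omega) _ _ _ _ h
    refine ⟨t, H', A', h.guard (.ite_true hw hn hrun), hres.imp_left ?_⟩
    exact fun ⟨ht, hr, hk⟩ => ⟨ht, hr, fun j hj hjs => hk j hj (by omega)⟩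
  | @iteFalse e c₁ c₂ _ _ _ _ he _ ih =>
    obtain ⟨ns, hs⟩ := ih fun x hx => hc x (.inr hx)
    refine ⟨ns, fun α H₀ Hi Ai hg s hs' ρ Φ H A h => ?_⟩
    simp only [Cmd.numLoops] at hs' ⊢
    obtain ⟨w, hw, rfl⟩ := h.eval hg he
    obtain ⟨t, H', A', hrun, hres⟩ := hs α H₀ Hi Ai hg (s + c₁.numLoops) (by omega) _ _ _ _ h
    refine ⟨t, H', A', h.guard (.ite_false hw hrun), hres.imp_left ?_⟩
    exact fun ⟨ht, hr, hk⟩ => ⟨ht, hr, fun j hj hjs => hk j hj (by omega)⟩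
  | loopTrue he hn _ _ ih₁ ih₂ =>
    obtain ⟨ns₁, h₁⟩ := ih₁ fun x hx => hc x (.inr hx)
    obtain ⟨ns₂, h₂⟩ := ih₂ hc
    exact ⟨_, h₁.loopTrue hL he hn h₂⟩
  | loopFalse he => exact ⟨[], simulates_loopFalse hL he⟩
  | assign he =>
    have hx := hc _ (.inl rfl)
    obtain ⟨a, ha⟩ := Env.exists_of_mem_dom hx.mem
    refine ⟨[], fun α H₀ Hi Ai hg s hs ρ Φ H A h => ?_⟩
    obtain ⟨w, hw, hr⟩ := h.eval hg he
    exact ⟨[], H.set a w, A, h.guard (.assignVar ha hw (h.mem_dom hg ha)), .inl ⟨rfl,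
      ⟨ρ, Φ, h.set_var hL hg hx ha hr⟩,
      fun j hj _ => Env.lookup_set_of_ne hL.inj ha (hx.ne_g j hj).symm _ _⟩⟩
  | load he hm =>
    have hx := hc _ (.inl rfl)
    obtain ⟨a, ha⟩ := Env.exists_of_mem_dom hx.mem
    refine ⟨[], fun α H₀ Hi Ai hg s hs ρ Φ H A h => ?_⟩
    obtain ⟨w, hw, b, k, j, hρ, rfl, rfl⟩ := h.eval hg he
    -- A pointer in the domain of the heap is in bounds, so its offset is a natural number and its
    -- address is valid.
    obtain ⟨b', k', j', o, w, hρ', hk, rfl, ho, hbo, hr⟩ := h.heap hm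
    obtain ⟨rfl, rfl, rfl⟩ : b = b' ∧ k = k' ∧ j = j' := by simpa [hρ] using hρ'
    refine ⟨[], H.set a w, A, h.guard (.assignVar ha ?_ (h.mem_dom hg ha)), .inl ⟨rfl,
      ⟨ρ, Φ, h.set_var hL hg hx ha hr⟩,
      fun j hj _ => Env.lookup_set_of_ne hL.inj ha (hx.ne_g j hj).symm _ _⟩⟩
    simp only [Notac.Expr.eval, hw, Option.bind_some]
    rw [← Nat.cast_add, Notac.toAddr_natCast, Option.bind_some, hbo]
  | store he hm hv =>
    refine ⟨[], fun α H₀ Hi Ai hg s hs ρ Φ H A h => ?_⟩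
    obtain ⟨w, hw, b, k, j, hρ, rfl, rfl⟩ := h.eval hg he
    obtain ⟨u, hu⟩ := FinPMap.exists_of_mem_dom hm
    obtain ⟨b', k', j', o, w', hρ', hk, rfl, ho, hbo, -⟩ := h.heap hu
    obtain ⟨rfl, rfl, rfl⟩ : b = b' ∧ k = k' ∧ j = j' := by simpa [hρ] using hρ'
    obtain ⟨z, hz, hr⟩ := h.eval hg hv
    have hR := h.tracked.notMem_reserved hg (mem_addresses (h.placed hρ) ho)
    refine ⟨[], H.set (b + o) z, A, h.guard (.silent (.assign ?_ hz
      (FinPMap.mem_dom_of_eq hbo)) .refl), .inl ⟨rfl, ⟨ρ, Φ, h.set_block hg hρ ho hr⟩,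
      fun j hj _ => Rep.lookup_set_addr hR _ _⟩⟩
    simp only [Notac.LVal.eval, hw, Option.bind_some]
    rw [← Nat.cast_add, Notac.toAddr_natCast]
  | @alloc x e n i l m he hn hi =>
    lift n to ℕ using hn
    exact ⟨[n], simulates_alloc hL (hc _ (.inl rfl)) he hi⟩

/-- There are no blocks yet, and `basic3` for the empty run says that initialisation keeps the
values of the variables. -/
theorem Rep.init (hg : GoodInit α E.range H₀ Hi Ai)
    (hl : ∀ x v, l x = some v → ∃ n, v = .int n)
    (hl0 : ∀ x n, l x = some (.int n) → E.lookup H₀ x = some n)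
    (hoom : E.lookup H₀ oom = some 0) (hti : E.lookup H₀ ti = some 0)
    (hunused : ∀ j < N, l (g j) = none) :
    Rep E oom ti g N α Hi Ai (fun _ => none) ∅ l FinPMap.empty Hi Ai := by
  have hkeep : HeapEq E.range H₀ Hi := (hg [] [] Hi Ai ∅ .empty).basic3
  refine ⟨.init, by simp, by simp, fun {x v} hx => ?_, fun h => by simp [FinPMap.empty] at h,
    ?_, ?_, hunused⟩
  · obtain ⟨n, rfl⟩ := hl _ _ hx
    exact ⟨n, by rw [← Env.lookup_congr hkeep, hl0 x n hx], rfl⟩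
  · rw [← Env.lookup_congr hkeep, hoom]
  · rw [← Env.lookup_congr hkeep, hti]

end

end Memsafe

/-! ### The theorem -/

theorem mainTheorem1
    -- a Memsafe program that runs without error from an empty heap and a store without pointers
    (p : Memsafe.Cmd) (l l' : Memsafe.Store) (m' : Memsafe.Heap)
    (hrun : Memsafe.Eval p l FinPMap.empty l' m')
    (hl : ∀ x v, l x = some v → ∃ n, v = Memsafe.Val.int n)
    -- the dedicated variables and the fresh guard variables of the translation
    (oom ti : Var) (g : ℕ → Var)
    (hne : oom ≠ ti) (hoom : oom ∉ p.vars) (hti : ti ∉ p.vars)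
    (hginj : Set.InjOn g {j | j < p.numLoops})
    (hg : ∀ j < p.numLoops, g j ∉ p.vars ∧ g j ∉ l.dom ∧ g j ≠ oom ∧ g j ≠ ti)
    (c : Notac.Cmd) (hc : c = p.toNotac oom ti g 0)
    -- a compatible environment and initial heap that represent the initial store
    (E : Notac.Env) (H₀ : Mem) (hE : E.Inj) (hcompat : E.Compatible H₀)
    (hvars : p.vars ⊆ E.dom) (hgdom : ∀ j < p.numLoops, g j ∈ E.dom)
    (hoom0 : E.lookup H₀ oom = some 0) (hti0 : E.lookup H₀ ti = some 0)
    (hl0 : ∀ x n, l x = some (Memsafe.Val.int n) → E.lookup H₀ x = some n) :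
    Notac.GAI.{u} c E H₀ ∧
    ∀ α ∈ Notac.stratsFor.{u} E, ∀ H A, α.init H₀ = (H, A) →
      (∃ t H' A', Notac.Steps E α (some c) H A t none H' A') ∧
      ∀ t H' A', Notac.Steps E α (some c) H A t none H' A' →
        E.lookup H' oom = some 0 →
        ∀ x n, l' x = some (Memsafe.Val.int n) → E.lookup H' x = some n := by
  subst hc
  have hmem : ∀ {x : Var} {v : ℤ}, E.lookup H₀ x = some v → x ∈ E.dom := by
    intro x v h hx
    simp [Notac.Env.lookup, hx] at h
  have hL : Memsafe.Layout E oom ti g p.numLoops :=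
    ⟨hE, hmem hoom0, hmem hti0, hne, hginj, hgdom, fun j hj => (hg j hj).2.2.1,
      fun j hj => (hg j hj).2.2.2⟩
  obtain ⟨ns, hsim⟩ := Memsafe.exists_simulates.{u} hL hrun fun x hx =>
    ⟨hvars hx, fun e => hoom (e ▸ hx), fun e => hti (e ▸ hx), fun j hj e => (hg j hj).1 (e ▸ hx)⟩
  have main : ∀ α ∈ Notac.stratsFor.{u} E, ∀ H A, α.init H₀ = (H, A) → ∃ t H' A',
      Notac.Steps E α (some (p.toNotac oom ti g 0)) H A t none H' A' ∧ Notac.AllocTrace ns t ∧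
      (E.lookup H' oom = some 0 →
        ∀ x n, l' x = some (Memsafe.Val.int n) → E.lookup H' x = some n) := by
    intro α hα H A hi
    have hgood : GoodInit α E.range H₀ H A := fun χs ξ H₁ A₁ Φ₁ hf =>
      hα H₀ H A χs ξ H₁ A₁ Φ₁ hcompat hi hf
    have hrep := Memsafe.Rep.init hgood hl hl0 hoom0 hti0 fun j hj =>
      not_not.1 (hg j hj).2.1
    obtain ⟨t, H', A', hs, ⟨ht, ⟨ρ, Φ, hr⟩, -⟩ | ⟨ht, hx⟩⟩ :=
      hsim α H₀ H A hgood 0 (by omega) _ _ _ _ hrep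
    · refine ⟨t, H', A', hs, .inl ht, fun _ x n hx => ?_⟩
      obtain ⟨w, hw, rfl⟩ := hr.store hx
      exact hw
    · refine ⟨t, H', A', hs, .inr ht, fun ho => ?_⟩
      obtain ⟨v, hv, hv'⟩ := hx.oom_ne
      -- A run that failed ends with `oom` non-zero, so nothing is claimed about its variables.
      exact absurd (Option.some.inj (hv'.symm.trans ho)) hv
  refine ⟨Notac.gai_of_allocTrace ns fun α hα H A hi => ?_, fun α hα H A hi => ?_⟩
  · obtain ⟨t, H', A', hs, ht, -⟩ := main α hα H A hi
    exact ⟨t, H', A', hs, ht⟩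
  · obtain ⟨t, H', A', hs, -, hfin⟩ := main α hα H A hi
    refine ⟨⟨t, H', A', hs⟩, fun t₂ H₂ A₂ hs₂ => ?_⟩
    -- By determinism every terminating run ends in the configuration found by the simulation.
    obtain ⟨t₃, -, hs₃⟩ := hs.prefix_of_terminal hs₂
    obtain ⟨-, -, rfl, -⟩ := hs₃.of_none
    exact hfin
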